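/- Let $F:\mathbb{R}^n\rightrightarrows\mathbb{R}^n$ have nonempty, convex, compact values, be locally Lipschitz (each point has a neighbourhood $K$ and a constant $c>0$ with $F(z)\subset F(y)+c|z-y|\,B(0,1)$ for all $z,y\in K$), and satisfy $|v|\le\gamma(1+|x|)$ for all $x\in\mathbb{R}^n$, $v\in F(x)$, with some $\gamma>0$. Let $H(x,p)=\sup_{v\in F(x)}\langle v,p\rangle$ and suppose that for every $r>0$: (i) there is $c\ge 0$ such that for every unit vector $p$ the function $H(\cdot,p)$ is semiconvex with constant $c$ on the closed ball $B(0,r)$; (ii) $\nabla_pH(x,p)$ exists for all $x\in B(0,r)$ and $p\ne0$, and is Lipschitz in $x$ on $B(0,r)$ with a constant independent of $p\neq 0$. Here $f$ is semiconcave on $\Omega$ with constant $c$ if it is continuous on $\Omega$ and $f(x+h)+f(x-h)-2f(x)\le c|h|^2$ whenever $[x-h,x+h]\subset\Omega$; $f$ is semiconvex if $-f$ is semiconcave; and $f$ is locally semiconcave if every point has an open neighbourhood on which $f$ is semiconcave with some constant. Let $\phi:\mathbb{R}^n\to\mathbb{R}$ be locally Lipschitz and $T\in\mathbb{R}$. For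 $t\le T$ and $x\in\mathbb{R}^n$ let $$V(t,x)=\inf\{\phi(y(T)) : y:[t,T]\to\mathbb{R}^n \text{ absolutely continuous},\ \dot y(s)\in F(y(s)) \text{ for a.e. } s\in[t,T],\ y(t)=x\}.$$ For $f:\mathbb{R}^n\to\mathbb{R}$ let $\partial^-f(x)$ (resp. $\partial^+f(x)$) be the set of all $p\in\mathbb{R}^n$ with $\liminf_{y\to x}\frac{f(y)-f(x)-\langle p,y-x\rangle}{|y-x|}\ge0$ (resp. $\limsup_{y\to x}\frac{f(y)-f(x)-\langle p,y-x\rangle}{|y-x|}\le0$); subscripts denote partial sub- and superdifferentials. Let $t_0\le T$, $x_0\in\mathbb{R}^n$, and let $\bar x:[t_0,T]\to\mathbb{R}^n$ be optimal, that is, $\bar x$ is admissible in the definition of $V(t_0,x_0)$ and $\phi(\bar x(T))\le\phi(y(T))$ for every admissible $y$. Let $\bar p:[t_0,T]\to\mathbb{R}^n$ be absolutely continuous and such that $$\dot{\bar x}(s)\in\partial_p^-H(\bar x(s),\bar p(s)),\qquad -\dot{\bar p}(s)\in\partial_x^-H(\bar x(s),\bar p(s))\qquad\text{for a.e. }s\in[t_0,T],\qquad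 -\bar p(T)\in\partial^+\phi(\bar x(T)).$$ Suppose that $\partial_x^-V(t_0,x_0)\neq\emptyset$. Then: 1. $V(t,\cdot)$ is (Fréchet) differentiable at $\bar x(t)$ with $\nabla_xV(t,\bar x(t))=-\bar p(t)$ for all $t\in[t_0,T]$. 2. If, moreover, $\phi$ is locally semiconcave, then $V$ is (Fréchet) differentiable, as a function of both variables, at $(t,\bar x(t))$ with $\nabla V(t,\bar x(t))=\bigl(H(\bar x(t),\bar p(t)),-\bar p(t)\bigr)$ for all $t\in[t_0,T)$. -/

import Mathlib

open Set Filter Topology MeasureTheory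
open scoped Pointwise

noncomputable section

namespace Mayer

/-- The Euclidean space `ℝⁿ`. -/
abbrev Rn (n : ℕ) : Type := EuclideanSpace ℝ (Fin n)

variable {n : ℕ}

/-! ### Nonsmooth analysis -/

/-- The Fréchet subdifferential of `f` at `x`. The quotient is regarded as an extended real, so
that the `liminf` is the true one (possibly infinite). -/
def frechetSub (f : Rn n → ℝ) (x : Rn n) : Set (Rn n) :=
  {p | (0 : EReal) ≤
    liminf (fun y => (((f y - f x - inner ℝ p (y - x)) / ‖y - x‖ : ℝ) : EReal)) (𝓝[≠] x)}

/-- The Fréchet superdifferential of `f` at `x`. -/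
def frechetSuper (f : Rn n → ℝ) (x : Rn n) : Set (Rn n) :=
  {p | limsup (fun y => (((f y - f x - inner ℝ p (y - x)) / ‖y - x‖ : ℝ) : EReal)) (𝓝[≠] x)
    ≤ (0 : EReal)}

/-- `f` is semiconcave on `Ω` with constant `c`. -/
def SemiconcaveOnWith (c : ℝ) (f : Rn n → ℝ) (Ω : Set (Rn n)) : Prop :=
  ContinuousOn f Ω ∧ ∀ x h : Rn n, segment ℝ (x - h) (x + h) ⊆ Ω →
    f (x + h) + f (x - h) - 2 * f x ≤ c * ‖h‖ ^ 2

/-- `f` is semiconvex on `Ω` with constant `c`: `-f` is semiconcave. -/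
def SemiconvexOnWith (c : ℝ) (f : Rn n → ℝ) (Ω : Set (Rn n)) : Prop :=
  SemiconcaveOnWith c (fun x => -f x) Ω

/-- `f` is semiconcave in an open neighbourhood of every point. -/
def LocallySemiconcave (f : Rn n → ℝ) : Prop :=
  ∀ x : Rn n, ∃ Ω : Set (Rn n), IsOpen Ω ∧ x ∈ Ω ∧ ∃ c : ℝ, SemiconcaveOnWith c f Ω

/-! ### The differential inclusion and its Hamiltonian -/

/-- The Hamiltonian `H(x,p) = sup_{v ∈ F(x)} ⟨v,p⟩`. -/
def hamiltonian (F : Rn n → Set (Rn n)) (x p : Rn n) : ℝ :=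
  sSup ((fun v => inner ℝ v p) '' F x)

/-- The standing hypotheses (SH) on the multifunction `F`. -/
structure StandingHyp (F : Rn n → Set (Rn n)) : Prop where
  nonempty : ∀ x, (F x).Nonempty
  convex : ∀ x, Convex ℝ (F x)
  compact : ∀ x, IsCompact (F x)
  locallyLipschitz : ∀ x, ∃ K ∈ 𝓝 x, ∃ c : ℝ, 0 < c ∧ ∀ z ∈ K, ∀ y ∈ K,
    F z ⊆ F y + (c * ‖z - y‖) • Metric.closedBall (0 : Rn n) 1
  linearGrowth : ∃ γ : ℝ, 0 < γ ∧ ∀ x, ∀ v ∈ F x, ‖v‖ ≤ γ * (1 + ‖x‖)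

/-- The hypotheses (H) on the Hamiltonian of `F`; `gradient (hamiltonian F x) p` is `∇ₚH(x,p)`. -/
structure HamiltonianHyp (F : Rn n → Set (Rn n)) : Prop where
  semiconvex : ∀ r : ℝ, 0 < r → ∃ c : ℝ, 0 ≤ c ∧ ∀ p : Rn n, ‖p‖ = 1 →
    SemiconvexOnWith c (fun x => hamiltonian F x p) (Metric.closedBall 0 r)
  differentiable : ∀ r : ℝ, 0 < r → ∀ x ∈ Metric.closedBall (0 : Rn n) r, ∀ p : Rn n, p ≠ 0 →
    DifferentiableAt ℝ (hamiltonian F x) p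
  lipschitz_gradient : ∀ r : ℝ, 0 < r → ∃ k : NNReal, ∀ p : Rn n, p ≠ 0 →
    LipschitzOnWith k (fun x => gradient (hamiltonian F x) p) (Metric.closedBall 0 r)

/-- `x` is an absolutely continuous solution on `[t₀,T]` of `ẋ(s) ∈ F(x(s))` a.e., `x(t₀) = x₀`.
(Only the values of `x` on `[t₀,T]` matter: the null set of exceptional times absorbs the
endpoints.) -/
structure IsTrajectory (F : Rn n → Set (Rn n)) (T t₀ : ℝ) (x₀ : Rn n) (x : ℝ → Rn n) :
    Prop where
  ac : AbsolutelyContinuousOnInterval x t₀ T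
  inclusion : ∀ᵐ s ∂(volume.restrict (Icc t₀ T)), ∃ v ∈ F (x s), HasDerivAt x v s
  initial : x t₀ = x₀

/-- `x` is an optimal solution of the Mayer problem `𝒫(t₀,x₀)`. -/
def IsOptimal (F : Rn n → Set (Rn n)) (φ : Rn n → ℝ) (T t₀ : ℝ) (x₀ : Rn n) (x : ℝ → Rn n) :
    Prop :=
  IsTrajectory F T t₀ x₀ x ∧ ∀ y : ℝ → Rn n, IsTrajectory F T t₀ x₀ y → φ (x T) ≤ φ (y T)

/-- The value function of the Mayer problem. It is meaningful for `t ≤ T`; there, under the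
standing hypotheses and for continuous `φ`, the infimum is over a nonempty set that is bounded
below. -/
def value (F : Rn n → Set (Rn n)) (φ : Rn n → ℝ) (T t : ℝ) (x : Rn n) : ℝ :=
  sInf {a | ∃ y : ℝ → Rn n, IsTrajectory F T t x y ∧ a = φ (y T)}

/-- `(x,p)` is a pair of arcs on `[t₀,T]` solving the Hamiltonian system
`ẋ ∈ ∂ₚ⁻H(x,p)`, `-ṗ ∈ ∂ₓ⁻H(x,p)` almost everywhere. -/
structure SolvesHamiltonianSystem (F : Rn n → Set (Rn n)) (T t₀ : ℝ) (x p : ℝ → Rn n) :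
    Prop where
  ac_x : AbsolutelyContinuousOnInterval x t₀ T
  ac_p : AbsolutelyContinuousOnInterval p t₀ T
  x_eq : ∀ᵐ s ∂(volume.restrict (Icc t₀ T)),
    ∃ v ∈ frechetSub (fun q => hamiltonian F (x s) q) (p s), HasDerivAt x v s
  p_eq : ∀ᵐ s ∂(volume.restrict (Icc t₀ T)),
    ∃ w : Rn n, -w ∈ frechetSub (fun y => hamiltonian F y (p s)) (x s) ∧ HasDerivAt p w s

end Mayer

end

namespace Mayer
variable {n : ℕ}

/-! ### Absolutely continuous functions -/

/-! The core is `exists_transport`. Given `t` and `y` near `x t`, there is a trajectory `z` on all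
of `[t₀,T]` through `(t,y)`, within `C‖y - x t‖` of `x`, along which `⟨p, z - x⟩` is nondecreasing
up to an error `C‖y - x t‖²`. Indeed `z` can be made to follow velocities that maximise the pairing
with `p`, as `x` does; then the derivative of `⟨p, z - x⟩` is `⟨ṗ, z - x⟩ + H(z,p) - H(x,p)`, and
since `-ṗ` is a subgradient of the semiconvex `H(·,p)` at `x`, this is bounded below by a quadratic
term. When `p ≠ 0` such a `z` solves `ż = ∇ₚH(z,p)`; otherwise `p` vanishes identically and any
nearby trajectory will do.

Following `z` forward to `T` and using `-p T ∈ ∂⁺φ` gives `value_le_near`: `-p t` is a supergradient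
of `V(t,·)`, uniformly in `t`. A subgradient at `t₀` must therefore equal `-p t₀`. Following `z`
backward to `t₀`, where dynamic programming gives `V(t₀, z t₀) ≤ V(t,y)`, yields `le_value_near`:
`-p t` is also a subgradient of `V(t,·)`. The two bounds give the spatial gradient.

For the joint gradient, a nearby time `r` is compared with `t` in four ways, by the sign of `r - t`
and the direction of the inequality. Two use that no trajectory advances faster than `H` in the
direction `p`, two use short trajectories that attain this speed to first order
(`exists_displacement`, `exists_short_estimate`). -/

theorem ac_comp_lipschitz {X Y : Type*} [PseudoMetricSpace X] [PseudoMetricSpace Y] {f : ℝ → X}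
    {g : X → Y} {K : NNReal} {a b : ℝ} (hf : AbsolutelyContinuousOnInterval f a b)
    (hg : LipschitzWith K g) : AbsolutelyContinuousOnInterval (fun s => g (f s)) a b := by
  have h := Tendsto.const_mul (K : ℝ) hf
  rw [mul_zero] at h
  refine squeeze_zero (fun E => Finset.sum_nonneg fun i _ => dist_nonneg) (fun E => ?_) h
  rw [Finset.mul_sum]
  exact Finset.sum_le_sum fun i _ => hg.dist_le_mul _ _

theorem ac_const {X : Type*} [PseudoMetricSpace X] (c : X) (a b : ℝ) :
    AbsolutelyContinuousOnInterval (fun _ : ℝ => c) a b :=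
  (LipschitzWith.const c).lipschitzOnWith.absolutelyContinuousOnInterval

theorem ac_sum {ι : Type*} (S : Finset ι) {f : ι → ℝ → ℝ} {a b : ℝ}
    (hf : ∀ i, AbsolutelyContinuousOnInterval (f i) a b) :
    AbsolutelyContinuousOnInterval (fun s => ∑ i ∈ S, f i s) a b := by
  classical
  induction S using Finset.induction_on with
  | empty => simpa using ac_const (0 : ℝ) a b
  | insert i S hi ih =>
    simp only [Finset.sum_insert hi]
    exact (hf i).add ih

theorem coord_lipschitz (i : Fin n) : LipschitzWith (α := Rn n) (β := ℝ) 1 (fun v => v i) :=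
  LipschitzWith.of_dist_le_mul fun v w => by
    have h := PiLp.norm_apply_le (v - w) i
    rw [NNReal.coe_one, one_mul, dist_eq_norm, dist_eq_norm]
    exact h

theorem ac_inner {f g : ℝ → Rn n} {a b : ℝ} (hf : AbsolutelyContinuousOnInterval f a b)
    (hg : AbsolutelyContinuousOnInterval g a b) :
    AbsolutelyContinuousOnInterval (fun s => inner ℝ (f s) (g s)) a b := by
  have h1 : ∀ i, AbsolutelyContinuousOnInterval (X := ℝ) (fun s => (f s) i) a b := by
    intro i
    have h := ac_comp_lipschitz hf (coord_lipschitz i)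
    exact h
  have h2 : ∀ i, AbsolutelyContinuousOnInterval (X := ℝ) (fun s => (g s) i) a b := by
    intro i
    have h := ac_comp_lipschitz hg (coord_lipschitz i)
    exact h
  have h3 : ∀ i, AbsolutelyContinuousOnInterval (X := ℝ) (fun s => (g s) i * (f s) i) a b := fun i =>
    (h2 i).fun_mul (h1 i)
  have e : (fun s => inner ℝ (f s) (g s)) = fun s => ∑ i, g s i * f s i := by
    funext s
    rw [PiLp.inner_apply]
    rfl
  rw [e]
  exact ac_sum Finset.univ h3

theorem ac_sub_le {f : ℝ → ℝ} {a b m : ℝ} (hab : a ≤ b)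
    (hf : AbsolutelyContinuousOnInterval f a b)
    (hd : ∀ᵐ s ∂(volume.restrict (Icc a b)), ∃ v, HasDerivAt f v s ∧ v ≤ m) :
    f b - f a ≤ m * (b - a) := by
  rw [← hf.integral_deriv_eq_sub]
  have : ∫ _ in a..b, m = m * (b - a) := by simp [mul_comm]
  rw [← this]
  refine intervalIntegral.integral_mono_ae_restrict hab hf.intervalIntegrable_deriv
    intervalIntegrable_const ?_
  filter_upwards [hd] with s ⟨v, hv, hvm⟩
  rwa [hv.deriv]

theorem ae_Icc_mono {a b c d : ℝ} {P : ℝ → Prop} (h : ∀ᵐ s ∂(volume.restrict (Icc a b)), P s)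
    (hs : Icc c d ⊆ Icc a b) : ∀ᵐ s ∂(volume.restrict (Icc c d)), P s :=
  ae_restrict_of_ae_restrict_of_subset hs h

theorem ac_mono {X : Type*} [PseudoMetricSpace X] {f : ℝ → X} {a b c d : ℝ} (hac : a ≤ c)
    (hcd : c ≤ d) (hdb : d ≤ b) (hf : AbsolutelyContinuousOnInterval f a b) :
    AbsolutelyContinuousOnInterval f c d :=
  hf.mono (by
    rw [uIcc_of_le hcd, uIcc_of_le (hac.trans (hcd.trans hdb))]; exact Icc_subset_Icc hac hdb)

/-- Gronwall's inequality for absolutely continuous functions. -/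
theorem ac_gronwall {f : ℝ → ℝ} {a b K : ℝ} (hab : a ≤ b)
    (hf : AbsolutelyContinuousOnInterval f a b)
    (hd : ∀ᵐ s ∂(volume.restrict (Icc a b)), ∃ v, HasDerivAt f v s ∧ v ≤ K * f s) :
    f b ≤ f a * Real.exp (K * (b - a)) := by
  have he : AbsolutelyContinuousOnInterval (fun s => Real.exp (-K * s)) a b :=
    ContDiffOn.absolutelyContinuousOnInterval (by fun_prop)
  have h := ac_sub_le (m := 0) hab (hf.mul he) (by
    filter_upwards [hd] with s ⟨v, hv, hvm⟩
    have h1 : HasDerivAt (fun s => Real.exp (-K * s)) (Real.exp (-K * s) * (-K)) s := by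
      simpa using ((hasDerivAt_id s).const_mul (-K)).exp
    refine ⟨_, hv.mul h1, ?_⟩
    nlinarith [Real.exp_pos (-K * s)])
  simp only [Pi.mul_apply, zero_mul, sub_nonpos] at h
  have e1 : Real.exp (K * (b - a)) = Real.exp (-K * a) * Real.exp (K * b) := by
    rw [← Real.exp_add]; ring_nf
  have e2 : Real.exp (-K * b) * Real.exp (K * b) = 1 := by
    rw [← Real.exp_add]; simp
  calc f b = f b * Real.exp (-K * b) * Real.exp (K * b) := by rw [mul_assoc, e2, mul_one]
    _ ≤ f a * Real.exp (-K * a) * Real.exp (K * b) := by gcongr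
    _ = _ := by rw [e1]; ring

theorem ac_norm_sub_le {f : ℝ → Rn n} {a b M : ℝ} (hab : a ≤ b)
    (hf : AbsolutelyContinuousOnInterval f a b)
    (hd : ∀ᵐ s ∂(volume.restrict (Icc a b)), ∃ v, HasDerivAt f v s ∧ ‖v‖ ≤ M) :
    ‖f b - f a‖ ≤ M * (b - a) := by
  set e := f b - f a with he
  have h := ac_sub_le (m := ‖e‖ * M) hab (ac_inner (ac_const e a b) hf) (by
    filter_upwards [hd] with s ⟨v, hv, hvm⟩
    refine ⟨_, (hasDerivAt_const s e).inner ℝ hv, ?_⟩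
    simp only [inner_zero_left, add_zero]
    exact (real_inner_le_norm e v).trans (by gcongr))
  rw [← inner_sub_right, ← he, real_inner_self_eq_norm_sq] at h
  -- If `e = 0`, only `0 ≤ M * (b - a)` is at stake. On a nondegenerate interval the
  -- almost-everywhere bound holds at some point, which forces `M ≥ 0`.
  rcases (norm_nonneg e).eq_or_lt with h0 | h0
  · by_contra hcon
    rw [not_le, ← h0] at hcon
    rcases hab.eq_or_lt with rfl | hlt
    · simp at hcon
    have hM : M < 0 := by
      by_contra hM
      push Not at hM
      nlinarith
    have hne : (volume.restrict (Icc a b)) ≠ 0 := by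
      simp [Measure.restrict_eq_zero, hlt]
    have : NeBot (ae (volume.restrict (Icc a b))) := ae_neBot.2 hne
    obtain ⟨s, v, -, hv⟩ := hd.exists
    linarith [norm_nonneg v]
  · have : ‖e‖ * ‖e‖ ≤ ‖e‖ * (M * (b - a)) := by nlinarith
    exact le_of_mul_le_mul_left this h0

/-! ### Primitives of bounded measurable functions -/

theorem intervalIntegrable_of_bound {u : ℝ → Rn n} (hu : Measurable u) {M : ℝ}
    (hM : ∀ s, ‖u s‖ ≤ M) (a b : ℝ) : IntervalIntegrable u volume a b :=
  (intervalIntegrable_const (c := M)).mono_fun' hu.aestronglyMeasurable (ae_of_all _ hM)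

theorem primitive_sub {u : ℝ → Rn n} (hu : Measurable u) {M : ℝ} (hM : ∀ s, ‖u s‖ ≤ M)
    (t r s : ℝ) : (∫ τ in t..s, u τ) - ∫ τ in t..r, u τ = ∫ τ in r..s, u τ :=
  intervalIntegral.integral_interval_sub_left (intervalIntegrable_of_bound hu hM _ _)
    (intervalIntegrable_of_bound hu hM _ _)

theorem primitive_lipschitz {u : ℝ → Rn n} (hu : Measurable u) {M : ℝ} (hM : ∀ s, ‖u s‖ ≤ M)
    (t : ℝ) (y : Rn n) : LipschitzWith M.toNNReal (fun s => y + ∫ τ in t..s, u τ) := by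
  have hM0 : 0 ≤ M := (norm_nonneg _).trans (hM 0)
  refine LipschitzWith.of_dist_le_mul fun s r => ?_
  rw [dist_eq_norm, add_sub_add_left_eq_sub, primitive_sub hu hM, Real.coe_toNNReal _ hM0,
    Real.dist_eq]
  exact intervalIntegral.norm_integral_le_of_norm_le_const fun x _ => hM x

theorem primitive_hasDerivAt {u : ℝ → Rn n} (hu : Measurable u) {M : ℝ} (hM : ∀ s, ‖u s‖ ≤ M)
    (t : ℝ) (y : Rn n) : ∀ᵐ s, HasDerivAt (fun s => y + ∫ τ in t..s, u τ) (u s) s := by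
  have hl : LocallyIntegrable u volume := by
    refine (locallyIntegrable_const M).mono hu.aestronglyMeasurable (ae_of_all _ fun s => ?_)
    rw [Real.norm_eq_abs, abs_of_nonneg ((norm_nonneg _).trans (hM s))]
    exact hM s
  filter_upwards [LocallyIntegrable.ae_hasDerivAt_integral hl] with s hs
  exact (hs t).const_add y

theorem ac_eq_primitive {w u : ℝ → Rn n} {a b t : ℝ} (ht : t ∈ Icc a b)
    (hw : AbsolutelyContinuousOnInterval w a b) (hu : Measurable u) {M : ℝ} (hM : ∀ s, ‖u s‖ ≤ M)
    (hd : ∀ᵐ s ∂(volume.restrict (Icc a b)), HasDerivAt w (u s) s) :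
    ∀ s ∈ Icc a b, w s = w t + ∫ τ in t..s, u τ := by
  have hab : a ≤ b := ht.1.trans ht.2
  have h1 := (primitive_lipschitz hu hM t (w t)).lipschitzOnWith
    (s := uIcc a b) |>.absolutelyContinuousOnInterval
  obtain ⟨C, hC⟩ := (hw.sub h1).const_of_ae_hasDerivAt_zero (by
    rw [uIcc_of_le hab]
    filter_upwards [(ae_restrict_iff' measurableSet_Icc).1 hd, primitive_hasDerivAt hu hM t (w t)]
      with s h2 h3 hs
    simpa using (h2 hs).sub h3)
  rw [uIcc_of_le hab] at hC
  intro s hs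
  have h2 := hC t ht
  have h3 := hC s hs
  simp only [Pi.sub_apply, intervalIntegral.integral_same, add_zero, sub_self] at h2 h3
  rw [← h2] at h3
  exact sub_eq_zero.1 h3

end Mayer

namespace Mayer
variable {n : ℕ}

/-! ### Successive approximations for differential inclusions -/

/-- Integrating the exponential weight gains a factor `1 / k`. With `k = 2c` this makes the
successive approximations contract by `1/2` on an interval of any length. -/
theorem abs_integral_exp_le {k : ℝ} (hk : 0 < k) (t s : ℝ) :
    |∫ r in t..s, Real.exp (k * |r - t|)| ≤ Real.exp (k * |s - t|) / k := by
  rcases le_total t s with h | h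
  · have e : ∫ r in t..s, Real.exp (k * |r - t|) = ∫ r in t..s, Real.exp (k * (r - t)) :=
      intervalIntegral.integral_congr fun r hr => by
        rw [uIcc_of_le h] at hr
        simp only [abs_of_nonneg (sub_nonneg.2 hr.1)]
    have hd : ∀ r ∈ uIcc t s, HasDerivAt (fun r => Real.exp (k * (r - t)) / k)
        (Real.exp (k * (r - t))) r := fun r _ => by
      have := ((((hasDerivAt_id r).sub_const t).const_mul k).exp).div_const k
      simpa [hk.ne'] using this
    rw [e, intervalIntegral.integral_eq_sub_of_hasDerivAt hd (by
      apply Continuous.intervalIntegrable; fun_prop), abs_of_nonneg (sub_nonneg.2 h)]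
    simp only [sub_self, mul_zero, Real.exp_zero]
    have : 1 ≤ Real.exp (k * (s - t)) := Real.one_le_exp (mul_nonneg hk.le (sub_nonneg.2 h))
    rw [abs_of_nonneg (by rw [← sub_div]; exact div_nonneg (by linarith) hk.le)]
    have : (0 : ℝ) < 1 / k := by positivity
    linarith
  · have e : ∫ r in t..s, Real.exp (k * |r - t|) = ∫ r in t..s, Real.exp (k * (t - r)) :=
      intervalIntegral.integral_congr fun r hr => by
        rw [uIcc_of_ge h] at hr
        simp only [abs_sub_comm r t, abs_of_nonneg (sub_nonneg.2 hr.2)]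
    have hd : ∀ r ∈ uIcc t s, HasDerivAt (fun r => -(Real.exp (k * (t - r)) / k))
        (Real.exp (k * (t - r))) r := fun r _ => by
      have := (((((hasDerivAt_id r).const_sub t).const_mul k).exp).div_const k).fun_neg
      convert! this using 1
      field_simp
      simp
    rw [e, intervalIntegral.integral_eq_sub_of_hasDerivAt hd (by
      apply Continuous.intervalIntegrable; fun_prop), abs_sub_comm s t,
      abs_of_nonneg (sub_nonneg.2 h)]
    simp only [sub_self, mul_zero, Real.exp_zero]
    have : 1 ≤ Real.exp (k * (t - s)) := Real.one_le_exp (mul_nonneg hk.le (sub_nonneg.2 h))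
    rw [abs_of_nonpos (by
      have : 1 / k ≤ Real.exp (k * (t - s)) / k := by gcongr
      linarith)]
    have : (0 : ℝ) < 1 / k := by positivity
    linarith

/-- The velocities of the successive approximations `u_{k+1}(s) = π(s, z_k(s), u_k(s))`, where
`z_k(s) = y + ∫_t^s u_k`. -/
noncomputable def approx (π : ℝ → Rn n → Rn n → Rn n) (a b t : ℝ) (y : Rn n) (u₀ : ℝ → Rn n) :
    ℕ → ℝ → Rn n
  | 0 => u₀
  | k + 1 => (Icc a b).indicator fun s =>
      π s (y + ∫ τ in t..s, approx π a b t y u₀ k τ) (approx π a b t y u₀ k s)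

/-- Picard iteration in the velocities. Every iterate after the first is already a value of `π`, so
`h2` need only control how `π s x u` moves when it is reprojected at a new state; no Lipschitz
dependence of `π` on the state with `u` fixed is required. This matters for metric projections onto
`F x`, for which `cproj_stability` gives only a square-root modulus. -/
theorem exists_selection_solution {π : ℝ → Rn n → Rn n → Rn n} {a b t c M η : ℝ} (hc : 0 < c)
    (ht : t ∈ Icc a b) {u₀ : ℝ → Rn n} (hu₀ : Measurable u₀) (hu₀M : ∀ s, ‖u₀ s‖ ≤ M) (y : Rn n)
    (h1 : ∀ s ∈ Icc a b, ∀ x u, ‖π s x u‖ ≤ M)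
    (h2 : ∀ s ∈ Icc a b, ∀ x x' u, ‖π s x' (π s x u) - π s x u‖ ≤ c * ‖x' - x‖)
    (h3 : ∀ s ∈ Icc a b, Continuous fun q : Rn n × Rn n => π s q.1 q.2)
    (h4 : ∀ z u : ℝ → Rn n, Continuous z → Measurable u → Measurable fun s => π s (z s) (u s))
    (h5 : ∀ s ∈ Icc a b, ‖π s (y + ∫ τ in t..s, u₀ τ) (u₀ s) - u₀ s‖ ≤ η) :
    ∃ u : ℝ → Rn n, Measurable u ∧ (∀ s, ‖u s‖ ≤ M) ∧ ∀ s ∈ Icc a b,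
      u s = π s (y + ∫ τ in t..s, u τ) (u s) ∧ ‖u s - u₀ s‖ ≤ 4 * η * Real.exp (2 * c * (b - a)) := by
  have hM0 : 0 ≤ M := (norm_nonneg _).trans (hu₀M 0)
  have hη0 : 0 ≤ η := (norm_nonneg _).trans (h5 t ht)
  set U := approx π a b t y u₀ with hU
  have hUs : ∀ k, ∀ s ∈ Icc a b, U (k + 1) s = π s (y + ∫ τ in t..s, U k τ) (U k s) :=
    fun k s hs => by rw [hU, approx, indicator_of_mem hs]
  have hU0 : ∀ k, ∀ s, s ∉ Icc a b → U (k + 1) s = 0 :=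
    fun k s hs => by rw [hU, approx, indicator_of_notMem hs]
  have hmb : ∀ k, Measurable (U k) ∧ ∀ s, ‖U k s‖ ≤ M := by
    intro k
    induction k with
    | zero => exact ⟨hu₀, hu₀M⟩
    | succ k ih =>
      refine ⟨?_, fun s => ?_⟩
      · exact (h4 _ _ (primitive_lipschitz ih.1 ih.2 t y).continuous ih.1).indicator
          measurableSet_Icc
      · by_cases hs : s ∈ Icc a b
        · rw [hUs k s hs]; exact h1 s hs _ _
        · rw [hU0 k s hs]; simpa using hM0
  -- Integration of the weight contributes `1 / (2c)` and `h2` contributes `c`, so each step halves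
  -- the gap. Summing `2η / 2 ^ k` produces the `4η` of the conclusion.
  have hstep : ∀ k, ∀ s ∈ Icc a b,
      ‖U (k + 1) s - U k s‖ ≤ 2 * η / 2 ^ k * Real.exp (2 * c * |s - t|) := by
    intro k
    induction k with
    | zero =>
      intro s hs
      rw [hUs 0 s hs]
      have he : 1 ≤ Real.exp (2 * c * |s - t|) := Real.one_le_exp (by positivity)
      calc _ ≤ η := h5 s hs
        _ ≤ 2 * η / 2 ^ 0 * 1 := by rw [pow_zero]; linarith
        _ ≤ _ := by gcongr
    | succ k ih =>
      intro s hs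
      have hsub : uIoc t s ⊆ Icc a b := fun r hr => by
        have := uIoc_subset_uIcc hr
        exact uIcc_subset_Icc ht hs this
      have hz : ‖(∫ τ in t..s, U (k + 1) τ) - ∫ τ in t..s, U k τ‖ ≤
          2 * η / 2 ^ k * (Real.exp (2 * c * |s - t|) / (2 * c)) := by
        rw [← intervalIntegral.integral_sub (intervalIntegrable_of_bound (hmb _).1 (hmb _).2 _ _)
          (intervalIntegrable_of_bound (hmb _).1 (hmb _).2 _ _)]
        calc _ ≤ |∫ r in t..s, 2 * η / 2 ^ k * Real.exp (2 * c * |r - t|)| := by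
              refine intervalIntegral.norm_integral_le_abs_of_norm_le ?_ ?_
              · filter_upwards [ae_restrict_mem measurableSet_uIoc] with r hr
                exact ih r (hsub hr)
              · apply Continuous.intervalIntegrable; fun_prop
          _ ≤ _ := by
              rw [intervalIntegral.integral_const_mul, abs_mul, abs_of_nonneg (by positivity)]
              gcongr
              exact abs_integral_exp_le (by positivity) t s
      have := h2 s hs (y + ∫ τ in t..s, U k τ) (y + ∫ τ in t..s, U (k + 1) τ) (U k s)
      rw [← hUs k s hs, ← hUs (k + 1) s hs, add_sub_add_left_eq_sub] at this
      calc _ ≤ c * (2 * η / 2 ^ k * (Real.exp (2 * c * |s - t|) / (2 * c))) :=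
            this.trans (by gcongr)
        _ = _ := by rw [pow_succ]; field_simp
  have hgeo : ∀ s ∈ Icc a b, ∀ k, dist (U k s) (U (k + 1) s) ≤
      4 * η * Real.exp (2 * c * (b - a)) / 2 / 2 ^ k := by
    intro s hs k
    rw [dist_comm, dist_eq_norm]
    have : |s - t| ≤ b - a := by rw [abs_le]; constructor <;> linarith [hs.1, hs.2, ht.1, ht.2]
    calc _ ≤ 2 * η / 2 ^ k * Real.exp (2 * c * |s - t|) := hstep k s hs
      _ ≤ 2 * η / 2 ^ k * Real.exp (2 * c * (b - a)) := by gcongr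
      _ = _ := by ring
  have hlim : ∀ s, ∃ v, Tendsto (fun k => U k s) atTop (𝓝 v) := by
    intro s
    by_cases hs : s ∈ Icc a b
    · exact cauchySeq_tendsto_of_complete (cauchySeq_of_le_geometric_two (hgeo s hs))
    · refine ⟨0, (tendsto_add_atTop_iff_nat 1).1 ?_⟩
      simp only [hU0 _ s hs]
      exact tendsto_const_nhds
  choose u hu using hlim
  have hum : Measurable u := measurable_of_tendsto_metrizable (fun k => (hmb k).1)
    (tendsto_pi_nhds.2 hu)
  have huM : ∀ s, ‖u s‖ ≤ M := fun s =>
    le_of_tendsto (hu s).norm (Eventually.of_forall fun k => (hmb k).2 s)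
  refine ⟨u, hum, huM, fun s hs => ⟨?_, ?_⟩⟩
  · have hz : Tendsto (fun k => y + ∫ τ in t..s, U k τ) atTop (𝓝 (y + ∫ τ in t..s, u τ)) := by
      refine tendsto_const_nhds.add ?_
      refine intervalIntegral.tendsto_integral_filter_of_dominated_convergence (fun _ => M)
        (Eventually.of_forall fun k => (hmb k).1.aestronglyMeasurable)
        (Eventually.of_forall fun k => ae_of_all _ fun s _ => (hmb k).2 s)
        intervalIntegrable_const (ae_of_all _ fun s _ => hu s)
    have hr := ((h3 s hs).tendsto (y + ∫ τ in t..s, u τ, u s)).comp (hz.prodMk_nhds (hu s))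
    refine tendsto_nhds_unique ((tendsto_add_atTop_iff_nat 1).2 (hu s)) (hr.congr fun k => ?_)
    simp only [Function.comp_apply, hUs k s hs]
  · have := dist_le_of_le_geometric_two_of_tendsto₀ (hgeo s hs) (hu s)
    rwa [dist_comm, dist_eq_norm] at this

end Mayer

namespace Mayer
variable {n : ℕ}

/-! ### Fréchet sub- and superdifferentials -/

theorem eventually_of_mem_frechetSub {f : Rn n → ℝ} {x p : Rn n} (h : p ∈ frechetSub f x) {ε : ℝ}
    (hε : 0 < ε) : ∀ᶠ y in 𝓝 x, -ε * ‖y - x‖ ≤ f y - f x - inner ℝ p (y - x) := by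
  have h1 : ((-ε : ℝ) : EReal) <
      liminf (fun y => (((f y - f x - inner ℝ p (y - x)) / ‖y - x‖ : ℝ) : EReal)) (𝓝[≠] x) :=
    lt_of_lt_of_le (by exact_mod_cast neg_lt_zero.2 hε) h
  have h2 := eventually_lt_of_lt_liminf h1
  rw [eventually_nhdsWithin_iff] at h2
  filter_upwards [h2] with y hy
  by_cases hyx : y = x
  · simp [hyx]
  have h3 := hy hyx
  rw [EReal.coe_lt_coe_iff, lt_div_iff₀ (norm_pos_iff.2 (sub_ne_zero.2 hyx))] at h3
  exact h3.le

theorem eventually_of_mem_frechetSuper {f : Rn n → ℝ} {x p : Rn n} (h : p ∈ frechetSuper f x)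
    {ε : ℝ} (hε : 0 < ε) : ∀ᶠ y in 𝓝 x, f y - f x - inner ℝ p (y - x) ≤ ε * ‖y - x‖ := by
  have h1 : limsup (fun y => (((f y - f x - inner ℝ p (y - x)) / ‖y - x‖ : ℝ) : EReal)) (𝓝[≠] x) <
      ((ε : ℝ) : EReal) := lt_of_le_of_lt h (by exact_mod_cast hε)
  have h2 := eventually_lt_of_limsup_lt h1
  rw [eventually_nhdsWithin_iff] at h2
  filter_upwards [h2] with y hy
  by_cases hyx : y = x
  · simp [hyx]
  have h3 := hy hyx
  rw [EReal.coe_lt_coe_iff, div_lt_iff₀ (norm_pos_iff.2 (sub_ne_zero.2 hyx))] at h3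
  exact h3.le

theorem eq_zero_of_inner_le {q : Rn n}
    (h : ∀ ε : ℝ, 0 < ε → ∀ᶠ y in 𝓝 (0 : Rn n), inner ℝ q y ≤ ε * ‖y‖) : q = 0 := by
  by_contra hq
  have hq0 : 0 < ‖q‖ := norm_pos_iff.2 hq
  have ht : Tendsto (fun t : ℝ => t • q) (𝓝[>] 0) (𝓝 0) := by
    have : Tendsto (fun t : ℝ => t • q) (𝓝 0) (𝓝 ((0 : ℝ) • q)) :=
      (continuous_id.smul continuous_const).tendsto 0
    rw [zero_smul] at this
    exact this.mono_left nhdsWithin_le_nhds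
  obtain ⟨t, ht1, ht2⟩ := ((ht.eventually (h (‖q‖ / 2) (by positivity))).and
    self_mem_nhdsWithin).exists
  have ht0 : 0 < t := ht2
  rw [inner_smul_right, real_inner_self_eq_norm_sq, norm_smul, Real.norm_of_nonneg ht0.le] at ht1
  have : 0 < t * ‖q‖ ^ 2 := by positivity
  nlinarith

theorem eq_gradient_of_mem_frechetSub {f : Rn n → ℝ} {x p : Rn n} (h : p ∈ frechetSub f x)
    (hd : DifferentiableAt ℝ f x) : p = gradient f x := by
  have hg := hasGradientAt_iff_isLittleO_nhds_zero.1 hd.hasGradientAt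
  refine sub_eq_zero.1 (eq_zero_of_inner_le fun ε hε => ?_)
  have h1 := eventually_of_mem_frechetSub h (half_pos hε)
  have ht : Tendsto (fun y : Rn n => x + y) (𝓝 0) (𝓝 x) :=
    (continuous_const.add continuous_id).tendsto' 0 x (by simp)
  filter_upwards [ht.eventually h1, hg.def (half_pos hε)] with y hy1 hy2
  rw [add_sub_cancel_left] at hy1
  rw [Real.norm_eq_abs] at hy2
  rw [inner_sub_left]
  linarith [(abs_le.1 hy2).2]

/-- A Fréchet subgradient of a semiconvex function is a proximal subgradient on the whole set. -/
theorem semiconvex_lower_bound {f : Rn n → ℝ} {c : ℝ} {Ω : Set (Rn n)} (hΩ : Convex ℝ Ω)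
    (hf : SemiconvexOnWith c f Ω) {x w y : Rn n} (hx : x ∈ Ω) (hy : y ∈ Ω)
    (hw : w ∈ frechetSub f x) :
    f x + inner ℝ w (y - x) - c / 2 * ‖y - x‖ ^ 2 ≤ f y := by
  set d := y - x with hd
  -- The quadratic correction is chosen so that midpoint semiconvexity reads exactly `ψ (l/2) ≤ ψ l
  -- / 2`. A negative `ψ 1` would then stay linearly negative along `2 ^ (-k)`, contradicting the
  -- subgradient property at `x`.
  set ψ : ℝ → ℝ := fun l => f (x + l • d) - f x - l * inner ℝ w d + c / 2 * l ^ 2 * ‖d‖ ^ 2 with hψ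
  have hmem : ∀ l ∈ Icc (0 : ℝ) 1, x + l • d ∈ Ω := fun l hl =>
    hΩ.add_smul_sub_mem hx hy hl
  have hhalf : ∀ l ∈ Icc (0 : ℝ) 1, ψ (l / 2) ≤ ψ l / 2 := by
    intro l hl
    have e1 : x + (l / 2) • d + (l / 2) • d = x + l • d := by module
    have e2 : x + (l / 2) • d - (l / 2) • d = x := by module
    have h := hf.2 (x + (l / 2) • d) ((l / 2) • d) (by
      rw [e1, e2]; exact hΩ.segment_subset hx (hmem l hl))
    rw [e1, e2, norm_smul, mul_pow, Real.norm_eq_abs, sq_abs] at h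
    simp only [hψ]
    nlinarith
  have hpow : ∀ k : ℕ, ψ ((1 / 2) ^ k) ≤ ψ 1 * (1 / 2) ^ k := by
    intro k
    induction k with
    | zero => simp
    | succ k ih =>
      have := hhalf ((1 / 2) ^ k) ⟨by positivity, pow_le_one₀ (by norm_num) (by norm_num)⟩
      rw [pow_succ]
      calc ψ ((1 / 2) ^ k * (1 / 2)) = ψ ((1 / 2) ^ k / 2) := by congr 1; ring
        _ ≤ ψ ((1 / 2) ^ k) / 2 := this
        _ ≤ _ := by linarith
  have hψ1 : 0 ≤ ψ 1 := by
    by_contra hneg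
    rw [not_le] at hneg
    have hε : 0 < -ψ 1 / (2 * (‖d‖ + 1)) := div_pos (by linarith) (by positivity)
    have hpt : Tendsto (fun k : ℕ => ((1 : ℝ) / 2) ^ k) atTop (𝓝 0) :=
      tendsto_pow_atTop_nhds_zero_of_lt_one (by norm_num) (by norm_num)
    have ht : Tendsto (fun k : ℕ => x + ((1 : ℝ) / 2) ^ k • d) atTop (𝓝 x) := by
      have := (hpt.smul_const d).const_add x
      simpa using this
    have hsq : Tendsto (fun k : ℕ => ((1 : ℝ) / 2) ^ k * (|c| / 2 * ‖d‖ ^ 2)) atTop (𝓝 0) := by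
      simpa using hpt.mul_const (|c| / 2 * ‖d‖ ^ 2)
    obtain ⟨k, hk1, hk2⟩ := ((ht.eventually (eventually_of_mem_frechetSub hw hε)).and
      (hsq.eventually (gt_mem_nhds (show (0 : ℝ) < -ψ 1 / 2 by linarith)))).exists
    have hk3 := hpow k
    set l := ((1 : ℝ) / 2) ^ k with hl
    have hl0 : 0 < l := by positivity
    rw [add_sub_cancel_left, norm_smul, Real.norm_of_nonneg hl0.le, inner_smul_right] at hk1
    have hk4 : ψ l ≥ -(-ψ 1 / (2 * (‖d‖ + 1))) * (l * ‖d‖) - l * (l * (|c| / 2 * ‖d‖ ^ 2)) := by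
      simp only [hψ] at hk1 ⊢
      have : -|c| * (l ^ 2 * ‖d‖ ^ 2) ≤ c * (l ^ 2 * ‖d‖ ^ 2) :=
        mul_le_mul_of_nonneg_right (neg_abs_le c) (by positivity)
      nlinarith
    have hk5 : -ψ 1 / (2 * (‖d‖ + 1)) * (l * ‖d‖) ≤ -ψ 1 / 2 * l := by
      have : ‖d‖ / (‖d‖ + 1) ≤ 1 := by rw [div_le_one (by positivity)]; linarith
      calc _ = -ψ 1 / 2 * l * (‖d‖ / (‖d‖ + 1)) := by field_simp
        _ ≤ -ψ 1 / 2 * l * 1 := by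
          gcongr
          exact mul_nonneg (by linarith) hl0.le
        _ = _ := mul_one _
    have hk6 : l * (l * (|c| / 2 * ‖d‖ ^ 2)) < l * (-ψ 1 / 2) := by gcongr
    nlinarith
  simp only [hψ, one_smul, one_mul, one_pow, mul_one] at hψ1
  rw [hd, add_sub_cancel] at hψ1
  linarith

/-! ### Regularity of the multifunction -/

/-- The hypothesis says that `F` is locally Lipschitz into nonempty compact sets with the Hausdorff
distance, and a locally Lipschitz map is Lipschitz on a compact set. A nearest point in `F x'` then
realises the bound. -/
theorem StandingHyp.exists_lipschitz_ball {F : Rn n → Set (Rn n)} (h : StandingHyp F) (R : ℝ) :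
    ∃ c : ℝ, 0 < c ∧ ∀ x ∈ Metric.closedBall (0 : Rn n) R, ∀ x' ∈ Metric.closedBall (0 : Rn n) R,
      ∀ v ∈ F x, ∃ v' ∈ F x', ‖v - v'‖ ≤ c * ‖x - x'‖ := by
  set G : Rn n → TopologicalSpace.NonemptyCompacts (Rn n) :=
    fun x => ⟨⟨F x, h.compact x⟩, h.nonempty x⟩ with hG
  have hloc : LocallyLipschitzOn (Metric.closedBall (0 : Rn n) R) G := by
    intro x _
    obtain ⟨K, hK, c, hc, hF⟩ := h.locallyLipschitz x
    refine ⟨c.toNNReal, K, mem_nhdsWithin_of_mem_nhds hK, ?_⟩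
    have key : ∀ z ∈ K, ∀ y ∈ K, ∀ v ∈ F z, ∃ v' ∈ F y, dist v v' ≤ c * ‖z - y‖ := by
      intro z hz y hy v hv
      obtain ⟨v', hv', w, hw, hvw⟩ := hF z hz y hy hv
      obtain ⟨b, hb, rfl⟩ := hw
      refine ⟨v', hv', ?_⟩
      rw [← hvw, dist_eq_norm]
      simp only [add_sub_cancel_left, norm_smul, Real.norm_eq_abs, abs_mul, abs_norm]
      rw [abs_of_pos hc]
      have : ‖b‖ ≤ 1 := by simpa using hb
      exact mul_le_of_le_one_right (by positivity) this
    refine LipschitzOnWith.of_dist_le_mul fun z hz y hy => ?_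
    rw [Metric.NonemptyCompacts.dist_eq, Real.coe_toNNReal _ hc.le, dist_eq_norm]
    refine Metric.hausdorffDist_le_of_mem_dist (by positivity) (key z hz y hy) fun v hv => ?_
    rw [norm_sub_rev]
    exact key y hy z hz v hv
  obtain ⟨K, hK⟩ := hloc.exists_lipschitzOnWith_of_compact (isCompact_closedBall _ _)
  refine ⟨K + 1, by positivity, fun x hx x' hx' v hv => ?_⟩
  obtain ⟨v', hv', hd⟩ := (h.compact x').exists_infDist_eq_dist (h.nonempty x') v
  refine ⟨v', hv', ?_⟩
  rw [← dist_eq_norm, ← hd]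
  have h1 : Metric.infDist v (F x') ≤ Metric.hausdorffDist (F x) (F x') :=
    Metric.infDist_le_hausdorffDist_of_mem hv (Metric.hausdorffEDist_ne_top_of_nonempty_of_bounded
      (h.nonempty x) (h.nonempty x') (h.compact x).isBounded (h.compact x').isBounded)
  have h2 := hK.dist_le_mul x hx x' hx'
  rw [Metric.NonemptyCompacts.dist_eq, dist_eq_norm] at h2
  exact h1.trans (h2.trans (mul_le_mul_of_nonneg_right (by linarith) (norm_nonneg _)))

theorem StandingHyp.exists_bound_ball {F : Rn n → Set (Rn n)} (h : StandingHyp F) (R : ℝ) :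
    ∃ M : ℝ, 0 < M ∧ ∀ x ∈ Metric.closedBall (0 : Rn n) R, ∀ v ∈ F x, ‖v‖ ≤ M := by
  obtain ⟨γ, hγ, hF⟩ := h.linearGrowth
  refine ⟨γ * (1 + |R|), by positivity, fun x hx v hv => (hF x v hv).trans ?_⟩
  have : ‖x‖ ≤ R := by simpa using hx
  gcongr
  exact this.trans (le_abs_self R)

/-! ### The Hamiltonian -/

section Hamiltonian
variable {F : Rn n → Set (Rn n)}

theorem StandingHyp.inner_le_hamiltonian (h : StandingHyp F) {x v : Rn n} (p : Rn n)
    (hv : v ∈ F x) : inner ℝ v p ≤ hamiltonian F x p :=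
  le_csSup ((h.compact x).image (by fun_prop)).bddAbove (mem_image_of_mem _ hv)

theorem StandingHyp.exists_eq_hamiltonian (h : StandingHyp F) (x p : Rn n) :
    ∃ v ∈ F x, inner ℝ v p = hamiltonian F x p := by
  obtain ⟨v, hv, he⟩ := ((h.compact x).image (f := fun v => inner ℝ v p) (by fun_prop)).sSup_mem
    ((h.nonempty x).image _)
  exact ⟨v, hv, he⟩

theorem StandingHyp.hamiltonian_zero (h : StandingHyp F) (x : Rn n) : hamiltonian F x 0 = 0 := by
  obtain ⟨v, -, hv⟩ := h.exists_eq_hamiltonian x 0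
  rw [← hv, inner_zero_right]

theorem StandingHyp.hamiltonian_smul (h : StandingHyp F) (x p : Rn n) {l : ℝ} (hl : 0 ≤ l) :
    hamiltonian F x (l • p) = l * hamiltonian F x p := by
  apply le_antisymm
  · obtain ⟨v, hv, he⟩ := h.exists_eq_hamiltonian x (l • p)
    rw [← he, inner_smul_right]
    exact mul_le_mul_of_nonneg_left (h.inner_le_hamiltonian p hv) hl
  · obtain ⟨v, hv, he⟩ := h.exists_eq_hamiltonian x p
    rw [← he, ← inner_smul_right]
    exact h.inner_le_hamiltonian _ hv

theorem hamiltonian_sub_le (h : StandingHyp F) {R c : ℝ}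
    (hc : ∀ x ∈ Metric.closedBall (0 : Rn n) R, ∀ x' ∈ Metric.closedBall (0 : Rn n) R,
      ∀ v ∈ F x, ∃ v' ∈ F x', ‖v - v'‖ ≤ c * ‖x - x'‖) {x x' : Rn n}
    (hx : x ∈ Metric.closedBall (0 : Rn n) R) (hx' : x' ∈ Metric.closedBall (0 : Rn n) R)
    (p : Rn n) : hamiltonian F x p - hamiltonian F x' p ≤ c * ‖x - x'‖ * ‖p‖ := by
  obtain ⟨v, hv, he⟩ := h.exists_eq_hamiltonian x p
  obtain ⟨v', hv', hd⟩ := hc x hx x' hx' v hv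
  have h1 := h.inner_le_hamiltonian p hv'
  have h2 := real_inner_le_norm (v - v') p
  rw [inner_sub_left] at h2
  have h3 : ‖v - v'‖ * ‖p‖ ≤ c * ‖x - x'‖ * ‖p‖ := by gcongr
  linarith

theorem hamiltonian_sub_le' (h : StandingHyp F) {M : ℝ} {x : Rn n} (hM : ∀ v ∈ F x, ‖v‖ ≤ M)
    (p p' : Rn n) : hamiltonian F x p - hamiltonian F x p' ≤ M * ‖p - p'‖ := by
  obtain ⟨v, hv, he⟩ := h.exists_eq_hamiltonian x p
  have h1 := h.inner_le_hamiltonian p' hv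
  have h2 := real_inner_le_norm v (p - p')
  rw [inner_sub_right] at h2
  have h3 : ‖v‖ * ‖p - p'‖ ≤ M * ‖p - p'‖ := by gcongr; exact hM v hv
  linarith

theorem StandingHyp.continuous_hamiltonian (h : StandingHyp F) :
    Continuous (Function.uncurry (hamiltonian F)) := by
  rw [continuous_iff_continuousAt]
  rintro ⟨x, p⟩
  obtain ⟨c, hc0, hc⟩ := h.exists_lipschitz_ball (‖x‖ + 1)
  obtain ⟨M, hM0, hM⟩ := h.exists_bound_ball (‖x‖ + 1)
  have hx : x ∈ Metric.closedBall (0 : Rn n) (‖x‖ + 1) := by simp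
  have hnear : ∀ᶠ q : Rn n × Rn n in 𝓝 (x, p), q.1 ∈ Metric.closedBall (0 : Rn n) (‖x‖ + 1) := by
    have : ∀ᶠ y in 𝓝 x, y ∈ Metric.closedBall (0 : Rn n) (‖x‖ + 1) :=
      mem_of_superset (Metric.isOpen_ball.mem_nhds
        (show x ∈ Metric.ball (0 : Rn n) (‖x‖ + 1) by simp)) Metric.ball_subset_closedBall
    exact (continuous_fst.tendsto (x, p)).eventually this
  have hb : Tendsto (fun q : Rn n × Rn n => c * ‖q.1 - x‖ * ‖q.2‖ + M * ‖q.2 - p‖) (𝓝 (x, p))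
      (𝓝 0) := by
    have hcont : Continuous fun q : Rn n × Rn n => c * ‖q.1 - x‖ * ‖q.2‖ + M * ‖q.2 - p‖ := by
      fun_prop
    exact hcont.tendsto' _ _ (by simp)
  refine tendsto_iff_dist_tendsto_zero.2 (squeeze_zero' (Eventually.of_forall fun _ => dist_nonneg)
    ?_ hb)
  filter_upwards [hnear] with q hq
  simp only [Function.uncurry]
  rw [Real.dist_eq, abs_le]
  have h1 := hamiltonian_sub_le h hc hq hx q.2
  have h2 := hamiltonian_sub_le h hc hx hq q.2
  have h3 := hamiltonian_sub_le' h (hM x hx) q.2 p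
  have h4 := hamiltonian_sub_le' h (hM x hx) p q.2
  rw [norm_sub_rev] at h2 h4
  constructor <;> linarith

theorem StandingHyp.measurable_gradient (h : StandingHyp F) :
    Measurable fun q : Rn n × Rn n => gradient (hamiltonian F q.1) q.2 :=
  (InnerProductSpace.toDual ℝ (Rn n)).symm.continuous.measurable.comp
    (measurable_fderiv_with_param ℝ h.continuous_hamiltonian)

/-- A maximiser in the definition of the Hamiltonian is its gradient. -/
theorem StandingHyp.gradient_eq (h : StandingHyp F) {x p v : Rn n} (hv : v ∈ F x)
    (he : inner ℝ v p = hamiltonian F x p) (hd : DifferentiableAt ℝ (hamiltonian F x) p) :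
    v = gradient (hamiltonian F x) p := by
  have hg := hasGradientAt_iff_isLittleO_nhds_zero.1 hd.hasGradientAt
  refine sub_eq_zero.1 (eq_zero_of_inner_le fun ε hε => ?_)
  filter_upwards [hg.def hε] with y hy
  have h1 := h.inner_le_hamiltonian (p + y) hv
  rw [Real.norm_eq_abs] at hy
  rw [inner_add_right] at h1
  rw [inner_sub_left]
  linarith [(abs_le.1 hy).2]

theorem StandingHyp.gradient_mem (h : StandingHyp F) {x p : Rn n}
    (hd : DifferentiableAt ℝ (hamiltonian F x) p) : gradient (hamiltonian F x) p ∈ F x ∧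
      inner ℝ (gradient (hamiltonian F x) p) p = hamiltonian F x p := by
  obtain ⟨v, hv, he⟩ := h.exists_eq_hamiltonian x p
  rw [← h.gradient_eq hv he hd]
  exact ⟨hv, he⟩

/-- The semiconvexity inequality for subgradients in `x`, for all momenta. -/
theorem hamiltonian_lower_bound (h : StandingHyp F) {R c : ℝ}
    (hc : ∀ p : Rn n, ‖p‖ = 1 →
      SemiconvexOnWith c (fun x => hamiltonian F x p) (Metric.closedBall 0 R))
    {x y w p : Rn n} (hx : x ∈ Metric.closedBall (0 : Rn n) R)
    (hy : y ∈ Metric.closedBall (0 : Rn n) R)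
    (hw : w ∈ frechetSub (fun z => hamiltonian F z p) x) :
    hamiltonian F x p + inner ℝ w (y - x) - c * ‖p‖ / 2 * ‖y - x‖ ^ 2 ≤ hamiltonian F y p := by
  refine semiconvex_lower_bound (f := fun z => hamiltonian F z p) (convex_closedBall _ _)
    ⟨?_, fun z k hz => ?_⟩ hx hy hw
  · have : Continuous fun z => -hamiltonian F z p :=
      (h.continuous_hamiltonian.comp (continuous_id.prodMk continuous_const)).neg
    exact this.continuousOn
  · by_cases hp : p = 0
    · simp [hp, h.hamiltonian_zero]
    have hp0 : 0 < ‖p‖ := norm_pos_iff.2 hp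
    -- Positive homogeneity in the momentum multiplies the unit-vector semiconvexity constant by
    -- `‖p‖`.
    have h1 := (hc (‖p‖⁻¹ • p) (norm_smul_inv_norm hp)).2 z k hz
    simp only [h.hamiltonian_smul _ p (inv_nonneg.2 hp0.le)] at h1
    have h2 := mul_le_mul_of_nonneg_left h1 hp0.le
    calc _ = ‖p‖ * (-(‖p‖⁻¹ * hamiltonian F (z + k) p) + -(‖p‖⁻¹ * hamiltonian F (z - k) p) -
          2 * -(‖p‖⁻¹ * hamiltonian F z p)) := by field_simp
      _ ≤ _ := h2
      _ = _ := by ring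

/-- `H(·,p)` is Lipschitz with constant `c‖p‖`; testing the subgradient inequality in its own
direction `w` gives the bound. It yields `‖ṗ‖ ≤ c‖p‖` along the adjoint arc. -/
theorem norm_le_of_mem_frechetSub_hamiltonian (h : StandingHyp F) {R c : ℝ} (hc0 : 0 < c)
    (hc : ∀ x ∈ Metric.closedBall (0 : Rn n) R, ∀ x' ∈ Metric.closedBall (0 : Rn n) R,
      ∀ v ∈ F x, ∃ v' ∈ F x', ‖v - v'‖ ≤ c * ‖x - x'‖) {x w p : Rn n}
    (hx : x ∈ Metric.ball (0 : Rn n) R)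
    (hw : w ∈ frechetSub (fun z => hamiltonian F z p) x) : ‖w‖ ≤ c * ‖p‖ := by
  refine le_of_forall_pos_le_add fun ε hε => ?_
  by_contra hlt
  rw [not_le] at hlt
  have hw0 : 0 < ‖w‖ := lt_of_le_of_lt (by positivity) hlt
  have ht : Tendsto (fun t : ℝ => x + t • w) (𝓝[>] 0) (𝓝 x) := by
    have : Continuous fun t : ℝ => x + t • w := by fun_prop
    exact (this.tendsto' 0 x (by simp)).mono_left nhdsWithin_le_nhds
  obtain ⟨t, ⟨h1, h2⟩, h3⟩ := ((ht.eventually ((eventually_of_mem_frechetSub hw hε).and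
    (Metric.isOpen_ball.mem_nhds hx))).and self_mem_nhdsWithin).exists
  have ht0 : 0 < t := h3
  have h4 := hamiltonian_sub_le h hc (Metric.ball_subset_closedBall h2)
    (Metric.ball_subset_closedBall hx) p
  rw [add_sub_cancel_left, norm_smul, Real.norm_of_nonneg ht0.le] at h1 h4
  rw [inner_smul_right, real_inner_self_eq_norm_sq] at h1
  have h5 : (t * ‖w‖) * ‖w‖ ≤ (t * ‖w‖) * (c * ‖p‖ + ε) := by nlinarith
  exact absurd (le_of_mul_le_mul_left h5 (by positivity)) (not_le.2 hlt)

end Hamiltonian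

end Mayer

namespace Mayer
variable {n : ℕ}

/-! ### Projections onto convex sets -/

open Classical in
/-- The metric projection onto a nonempty closed convex set. -/
noncomputable def cproj (K : Set (Rn n)) (u : Rn n) : Rn n :=
  if h : ∃ v ∈ K, ∀ w ∈ K, inner ℝ (u - v) (w - v) ≤ 0 then h.choose else 0

theorem cproj_spec {K : Set (Rn n)} (hne : K.Nonempty) (hcl : IsClosed K) (hcv : Convex ℝ K)
    (u : Rn n) : cproj K u ∈ K ∧ ∀ w ∈ K, inner ℝ (u - cproj K u) (w - cproj K u) ≤ 0 := by
  have h : ∃ v ∈ K, ∀ w ∈ K, inner ℝ (u - v) (w - v) ≤ 0 := by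
    obtain ⟨v, hv, he⟩ := exists_norm_eq_iInf_of_complete_convex hne hcl.isComplete hcv u
    exact ⟨v, hv, (norm_eq_iInf_iff_real_inner_le_zero hcv hv).1 he⟩
  rw [cproj, dif_pos h]
  exact h.choose_spec

/-- Stability of projections: the sets are at Hausdorff distance at most `η`. -/
theorem cproj_stability {K K' : Set (Rn n)} (hne : K.Nonempty) (hcl : IsClosed K)
    (hcv : Convex ℝ K) (hne' : K'.Nonempty) (hcl' : IsClosed K') (hcv' : Convex ℝ K') {η : ℝ}
    (h1 : ∀ v ∈ K, ∃ v' ∈ K', ‖v - v'‖ ≤ η) (h2 : ∀ v ∈ K', ∃ v' ∈ K, ‖v - v'‖ ≤ η)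
    (u : Rn n) :
    ‖cproj K u - cproj K' u‖ ^ 2 ≤ η * (‖u - cproj K u‖ + ‖u - cproj K' u‖) := by
  obtain ⟨hv, hvi⟩ := cproj_spec hne hcl hcv u
  obtain ⟨hv', hvi'⟩ := cproj_spec hne' hcl' hcv' u
  set v := cproj K u
  set v' := cproj K' u
  obtain ⟨w, hw, hwv⟩ := h1 v hv
  obtain ⟨w', hw', hwv'⟩ := h2 v' hv'
  have e1 := hvi w' hw'
  have e2 := hvi' w hw
  have e3 : inner ℝ (u - v) (v' - w') ≤ ‖u - v‖ * η :=
    (real_inner_le_norm _ _).trans (by gcongr)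
  have e4 : inner ℝ (u - v') (v - w) ≤ ‖u - v'‖ * η :=
    (real_inner_le_norm _ _).trans (by gcongr)
  have e5 : inner ℝ (u - v) (w' - v) + inner ℝ (u - v) (v' - w') = inner ℝ (u - v) (v' - v) := by
    rw [← inner_add_right, sub_add_sub_cancel']
  have e6 : inner ℝ (u - v') (w - v') + inner ℝ (u - v') (v - w) = inner ℝ (u - v') (v - v') := by
    rw [← inner_add_right, sub_add_sub_cancel']
  -- Each summand is a variational inequality tested at a point of the wrong set; replacing that
  -- point by its `η`-close partner in the right set costs `η` times the distance to `u`.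
  have e7 : ‖v - v'‖ ^ 2 = inner ℝ (u - v') (v - v') + inner ℝ (u - v) (v' - v) := by
    rw [← neg_sub v v', inner_neg_right, ← sub_eq_add_neg, ← inner_sub_left,
      ← real_inner_self_eq_norm_sq]
    congr 1
    abel
  rw [e7]
  linarith

theorem cproj_lipschitz {K : Set (Rn n)} (hne : K.Nonempty) (hcl : IsClosed K)
    (hcv : Convex ℝ K) (u u' : Rn n) : ‖cproj K u - cproj K u'‖ ≤ ‖u - u'‖ := by
  obtain ⟨hv, hvi⟩ := cproj_spec hne hcl hcv u
  obtain ⟨hv', hvi'⟩ := cproj_spec hne hcl hcv u'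
  set v := cproj K u
  set v' := cproj K u'
  have e1 := hvi v' hv'
  have e2 := hvi' v hv
  have e3 := real_inner_le_norm (u - u') (v - v')
  have e4 : ‖v - v'‖ ^ 2 = inner ℝ (u - u') (v - v') + inner ℝ (u - v) (v' - v) +
      inner ℝ (u' - v') (v - v') := by
    rw [← neg_sub v v', inner_neg_right, ← sub_eq_add_neg, ← inner_sub_left, ← inner_add_left,
      ← real_inner_self_eq_norm_sq]
    congr 1
    abel
  rcases (norm_nonneg (v - v')).eq_or_lt with h0 | h0
  · rw [← h0]; exact norm_nonneg _
  · refine le_of_mul_le_mul_right ?_ h0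
    nlinarith

theorem cproj_eq_self {K : Set (Rn n)} (hcl : IsClosed K) (hcv : Convex ℝ K) {u : Rn n}
    (hu : u ∈ K) : cproj K u = u := by
  obtain ⟨hv, hvi⟩ := cproj_spec ⟨u, hu⟩ hcl hcv u
  have := hvi u hu
  rw [real_inner_self_eq_norm_sq] at this
  have h0 : ‖u - cproj K u‖ = 0 := by nlinarith [norm_nonneg (u - cproj K u)]
  exact (sub_eq_zero.1 (norm_eq_zero.1 h0)).symm

theorem cproj_norm_sub_le {K : Set (Rn n)} (hcl : IsClosed K) (hcv : Convex ℝ K) {u w : Rn n}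
    (hw : w ∈ K) : ‖cproj K u - u‖ ≤ ‖w - u‖ := by
  obtain ⟨hv, hvi⟩ := cproj_spec ⟨w, hw⟩ hcl hcv u
  have e1 := hvi w hw
  set v := cproj K u
  have e2 := real_inner_le_norm (u - v) (u - w)
  have e3 : ‖u - v‖ ^ 2 = inner ℝ (u - v) (u - w) + inner ℝ (u - v) (w - v) := by
    rw [← inner_add_right, sub_add_sub_cancel, real_inner_self_eq_norm_sq]
  rw [norm_sub_rev v, norm_sub_rev w]
  rcases (norm_nonneg (u - v)).eq_or_lt with h0 | h0
  · rw [← h0]; exact norm_nonneg _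
  · refine le_of_mul_le_mul_left ?_ h0
    nlinarith

/-- The projection onto a closed ball centred at the origin. -/
noncomputable abbrev ballProj (R : ℝ) (x : Rn n) : Rn n := cproj (Metric.closedBall 0 R) x

theorem ballProj_mem {R : ℝ} (hR : 0 ≤ R) (x : Rn n) :
    ballProj R x ∈ Metric.closedBall (0 : Rn n) R :=
  (cproj_spec ⟨0, by simpa using hR⟩ Metric.isClosed_closedBall (convex_closedBall _ _) x).1

theorem ballProj_norm_sub_le {R : ℝ} (hR : 0 ≤ R) (x y : Rn n) :
    ‖ballProj R x - ballProj R y‖ ≤ ‖x - y‖ :=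
  cproj_lipschitz ⟨0, by simpa using hR⟩ Metric.isClosed_closedBall (convex_closedBall _ _) x y

theorem ballProj_eq_self {R : ℝ} {x : Rn n} (hx : x ∈ Metric.closedBall (0 : Rn n) R) :
    ballProj R x = x :=
  cproj_eq_self Metric.isClosed_closedBall (convex_closedBall _ _) hx

theorem continuous_ballProj {R : ℝ} (hR : 0 ≤ R) :
    Continuous (ballProj R : Rn n → Rn n) :=
  (LipschitzWith.of_dist_le_mul (K := 1) fun x y => by
    simpa [dist_eq_norm] using ballProj_norm_sub_le hR x y).continuous

/-! ### Selectors -/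

/-- A map driving the successive approximations; its fixed points are admissible velocities which
maximise the pairing with `p`. -/
structure IsSelector (F : Rn n → Set (Rn n)) (R c M : ℝ) (p : ℝ → Rn n) (a b : ℝ)
    (π : ℝ → Rn n → Rn n → Rn n) : Prop where
  bound : ∀ s x u, ‖π s x u‖ ≤ M
  lip : ∀ s x x' u, ‖π s x' (π s x u) - π s x u‖ ≤ c * ‖x' - x‖
  cont : ∀ s, Continuous fun q : Rn n × Rn n => π s q.1 q.2
  meas : ∀ z u : ℝ → Rn n, Continuous z → Measurable u → Measurable fun s => π s (z s) (u s)
  fixed : ∀ s ∈ Icc a b, ∀ x ∈ Metric.closedBall (0 : Rn n) R, ∀ v, v = π s x v →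
    v ∈ F x ∧ inner ℝ v (p s) = hamiltonian F x (p s)

section Selectors
variable {F : Rn n → Set (Rn n)}

/-- The projection is nonexpansive in the projected point and moves by at most a square root of the
Hausdorff displacement of the set. -/
theorem continuous_cproj_ballProj (h : StandingHyp F) {R : ℝ} (hR : 0 ≤ R) :
    Continuous fun q : Rn n × Rn n => cproj (F (ballProj R q.1)) q.2 := by
  obtain ⟨c, hc0, hc⟩ := h.exists_lipschitz_ball R
  obtain ⟨M, hM0, hM⟩ := h.exists_bound_ball R
  rw [continuous_iff_continuousAt]
  rintro ⟨x', u'⟩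
  have hb : Tendsto (fun q : Rn n × Rn n => ‖q.2 - u'‖ +
      Real.sqrt (c * ‖q.1 - x'‖ * (2 * (‖u'‖ + M)))) (𝓝 (x', u')) (𝓝 0) := by
    have : Continuous fun q : Rn n × Rn n => ‖q.2 - u'‖ +
      Real.sqrt (c * ‖q.1 - x'‖ * (2 * (‖u'‖ + M))) := by fun_prop
    exact this.tendsto' _ _ (by simp)
  refine tendsto_iff_dist_tendsto_zero.2 (squeeze_zero (fun _ => dist_nonneg) (fun q => ?_) hb)
  have sp := fun x u => cproj_spec (h.nonempty x) (h.compact x).isClosed (h.convex x) u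
  have hq := ballProj_mem hR q.1
  have hx := ballProj_mem hR x'
  have hqx := ballProj_norm_sub_le hR q.1 x'
  have hη : ∀ y ∈ Metric.closedBall (0 : Rn n) R, ‖u' - cproj (F y) u'‖ ≤ ‖u'‖ + M := fun y hy =>
    (norm_sub_le _ _).trans (by gcongr; exact hM y hy _ (sp y u').1)
  have h1 := cproj_stability (h.nonempty (ballProj R q.1)) (h.compact _).isClosed (h.convex _)
    (h.nonempty (ballProj R x')) (h.compact _).isClosed (h.convex _)
    (η := c * ‖q.1 - x'‖)
    (fun v hv => by
      obtain ⟨v', hv', hd⟩ := hc _ hq _ hx v hv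
      exact ⟨v', hv', hd.trans (by gcongr)⟩)
    (fun v hv => by
      obtain ⟨v', hv', hd⟩ := hc _ hx _ hq v hv
      rw [norm_sub_rev (ballProj R x')] at hd
      exact ⟨v', hv', hd.trans (by gcongr)⟩) u'
  have h2 := cproj_lipschitz (h.nonempty (ballProj R q.1)) (h.compact _).isClosed (h.convex _)
    q.2 u'
  rw [dist_eq_norm]
  refine (norm_sub_le_norm_sub_add_norm_sub _ (cproj (F (ballProj R q.1)) u') _).trans ?_
  refine add_le_add h2 (Real.le_sqrt_of_sq_le (h1.trans ?_))
  gcongr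
  linarith [hη _ hq, hη _ hx]

/-- The selector of Filippov's theorem. -/
theorem isSelector_cproj (h : StandingHyp F) {R c M : ℝ} (hR : 0 ≤ R) (hc0 : 0 < c)
    (hc : ∀ x ∈ Metric.closedBall (0 : Rn n) R, ∀ x' ∈ Metric.closedBall (0 : Rn n) R,
      ∀ v ∈ F x, ∃ v' ∈ F x', ‖v - v'‖ ≤ c * ‖x - x'‖)
    (hM : ∀ x ∈ Metric.closedBall (0 : Rn n) R, ∀ v ∈ F x, ‖v‖ ≤ M) {p : ℝ → Rn n} {a b : ℝ}
    (hp : ∀ s ∈ Icc a b, p s = 0) :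
    IsSelector F R c M p a b fun _ x u => cproj (F (ballProj R x)) u := by
  have sp := fun x u => cproj_spec (h.nonempty x) (h.compact x).isClosed (h.convex x) u
  refine ⟨fun s x u => hM _ (ballProj_mem hR x) _ (sp _ u).1, fun s x x' u => ?_,
    fun s => continuous_cproj_ballProj h hR, fun z u hz hu => ?_, fun s hs x hx v hv => ?_⟩
  · obtain ⟨v', hv', hd⟩ := hc _ (ballProj_mem hR x) _ (ballProj_mem hR x') _ (sp _ u).1
    refine (cproj_norm_sub_le (h.compact _).isClosed (h.convex _) hv').trans ?_
    rw [norm_sub_rev, norm_sub_rev x']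
    exact hd.trans (mul_le_mul_of_nonneg_left (ballProj_norm_sub_le hR x x') hc0.le)
  · have h1 := (continuous_cproj_ballProj h hR).measurable
    have h2 := h1.comp (hz.measurable.prodMk hu)
    exact h2
  · rw [ballProj_eq_self hx] at hv
    refine ⟨hv ▸ (sp x v).1, ?_⟩
    rw [hp s hs, inner_zero_right, h.hamiltonian_zero]

/-- The selector given by the gradient of the Hamiltonian. -/
theorem isSelector_gradient (h : StandingHyp F) (hH : HamiltonianHyp F) {R M : ℝ} {k : NNReal}
    (hR : 0 < R) (hk : ∀ p : Rn n, p ≠ 0 →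
      LipschitzOnWith k (fun x => gradient (hamiltonian F x) p) (Metric.closedBall 0 R))
    (hM : ∀ x ∈ Metric.closedBall (0 : Rn n) R, ∀ v ∈ F x, ‖v‖ ≤ M) {p : ℝ → Rn n} {a b : ℝ}
    (hab : a ≤ b) (hpc : ContinuousOn p (Icc a b)) (hp : ∀ s ∈ Icc a b, p s ≠ 0) :
    IsSelector F R (k + 1) M p a b fun s x _ =>
      gradient (hamiltonian F (ballProj R x)) (IccExtend hab ((Icc a b).domRestrict p) s) := by
  -- Extending `p` by its endpoint values keeps it continuous and nonzero for all times, as the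
  -- selector conditions are imposed on all of `ℝ`.
  have hp' : ∀ s, IccExtend hab ((Icc a b).domRestrict p) s ≠ 0 := fun s =>
    hp _ (projIcc a b hab s).2
  have hpcont : Continuous (IccExtend hab ((Icc a b).domRestrict p)) :=
    (continuousOn_iff_continuous_domRestrict.1 hpc).Icc_extend'
  have hdiff : ∀ s x, DifferentiableAt ℝ (hamiltonian F (ballProj R x))
      (IccExtend hab ((Icc a b).domRestrict p) s) := fun s x =>
    hH.differentiable R hR _ (ballProj_mem hR.le x) _ (hp' s)
  have hlip : ∀ s (x x' : Rn n),
      ‖gradient (hamiltonian F (ballProj R x')) (IccExtend hab ((Icc a b).domRestrict p) s) -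
        gradient (hamiltonian F (ballProj R x)) (IccExtend hab ((Icc a b).domRestrict p) s)‖ ≤
      (k + 1) * ‖x' - x‖ := by
    intro s x x'
    have h1 := (hk _ (hp' s)).dist_le_mul _ (ballProj_mem hR.le x') _ (ballProj_mem hR.le x)
    rw [dist_eq_norm, dist_eq_norm] at h1
    have h2 := ballProj_norm_sub_le hR.le x' x
    calc _ ≤ k * ‖ballProj R x' - ballProj R x‖ := h1
      _ ≤ (k + 1) * ‖x' - x‖ := by gcongr; linarith
  refine ⟨fun s x u => hM _ (ballProj_mem hR.le x) _ (h.gradient_mem (hdiff s x)).1,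
    fun s x x' u => hlip s x x', fun s => ?_, fun z u hz hu => ?_, fun s hs x hx v hv => ?_⟩
  · have : LipschitzWith (k + 1) fun x : Rn n =>
        gradient (hamiltonian F (ballProj R x)) (IccExtend hab ((Icc a b).domRestrict p) s) :=
      LipschitzWith.of_dist_le_mul fun x' x => by
        rw [dist_eq_norm, dist_eq_norm]; exact_mod_cast hlip s x x'
    exact this.continuous.comp continuous_fst
  · have h1 := ((continuous_ballProj hR.le).comp hz).measurable.prodMk hpcont.measurable
    have h2 := h.measurable_gradient.comp h1
    exact h2
  · have h1 := h.gradient_mem (hdiff s x)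
    rw [IccExtend_of_mem _ _ hs, ballProj_eq_self hx, domRestrict_apply] at h1
    rw [IccExtend_of_mem _ _ hs, ballProj_eq_self hx, domRestrict_apply] at hv
    rw [hv]
    exact h1

/-- Perturbing the initial point of an arc that follows a selector. -/
theorem IsSelector.exists_perturbed {R c M : ℝ} {p : ℝ → Rn n} {a b : ℝ}
    {π : ℝ → Rn n → Rn n → Rn n} (hπ : IsSelector F R c M p a b π) (hc : 0 < c) {w : ℝ → Rn n}
    (hab : a ≤ b) (hw : AbsolutelyContinuousOnInterval w a b)
    (hwd : ∀ᵐ s ∂(volume.restrict (Icc a b)), ∃ v, HasDerivAt w v s ∧ v = π s (w s) v) :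
    ∃ C : ℝ, 0 < C ∧ ∀ t ∈ Icc a b, ∀ y : Rn n, ∃ z : ℝ → Rn n, ∃ K : NNReal, z t = y ∧
      LipschitzWith K z ∧ (∀ s ∈ Icc a b, ‖z s - w s‖ ≤ C * ‖y - w t‖) ∧
      ∀ᵐ s ∂(volume.restrict (Icc a b)), ∃ v, HasDerivAt z v s ∧ v = π s (z s) v := by
  set E := Real.exp (2 * c * (b - a))
  refine ⟨1 + (b - a) * (4 * c * E), add_pos_of_pos_of_nonneg one_pos
    (mul_nonneg (sub_nonneg.2 hab) (by positivity)), fun t ht y => ?_⟩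
  set wc := IccExtend hab ((Icc a b).domRestrict w) with hwc
  have hwcont : Continuous wc := by
    have hc := hw.continuousOn
    rw [uIcc_of_le hab] at hc
    exact (continuousOn_iff_continuous_domRestrict.1 hc).Icc_extend'
  have hwc_eq : ∀ s ∈ Icc a b, wc s = w s := fun s hs => by rw [hwc, IccExtend_of_mem _ _ hs]; rfl
  -- An everywhere bounded, measurable version of `ẇ`: the two agree wherever the selector equation
  -- for `w` holds.
  set u₀ : ℝ → Rn n := fun s => π s (wc s) (deriv w s) with hu₀
  have hu₀m : Measurable u₀ := hπ.meas _ _ hwcont (measurable_deriv w)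
  have hu₀M : ∀ s, ‖u₀ s‖ ≤ M := fun s => hπ.bound _ _ _
  have hprim := ac_eq_primitive ht hw hu₀m hu₀M (by
    filter_upwards [hwd, ae_restrict_mem measurableSet_Icc] with s ⟨v, hv, hvπ⟩ hs
    rw [hu₀]
    simp only [hwc_eq s hs, hv.deriv, ← hvπ]
    exact hv)
  -- The first approximation is `w` translated by `y - w t`, whose distance to `w` is constant in
  -- time; hence the initial defect `c * ‖y - w t‖`.
  obtain ⟨u, hum, huM, hu⟩ := exists_selection_solution (η := c * ‖y - w t‖) hc ht hu₀m hu₀M y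
    (fun s _ => hπ.bound s) (fun s _ => hπ.lip s) (fun s _ => hπ.cont s) hπ.meas (by
      intro s hs
      refine (hπ.lip s (wc s) _ (deriv w s)).trans (le_of_eq ?_)
      rw [hwc_eq s hs, hprim s hs, add_sub_add_right_eq_sub])
  refine ⟨fun s => y + ∫ τ in t..s, u τ, M.toNNReal, by simp, primitive_lipschitz hum huM t y,
    fun s hs => ?_, ?_⟩
  · have h1 : ‖∫ τ in t..s, (u τ - u₀ τ)‖ ≤ 4 * (c * ‖y - w t‖) * E * |s - t| :=
      intervalIntegral.norm_integral_le_of_norm_le_const fun r hr =>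
        (hu r (uIcc_subset_Icc ht hs (uIoc_subset_uIcc hr))).2
    rw [intervalIntegral.integral_sub (intervalIntegrable_of_bound hum huM _ _)
      (intervalIntegrable_of_bound hu₀m hu₀M _ _)] at h1
    have h2 : |s - t| ≤ b - a := by rw [abs_le]; constructor <;> linarith [hs.1, hs.2, ht.1, ht.2]
    have h3 : 4 * (c * ‖y - w t‖) * E * |s - t| ≤ 4 * (c * ‖y - w t‖) * E * (b - a) := by gcongr
    have e : (y + ∫ τ in t..s, u τ) - w s =
        (y - w t) + ((∫ τ in t..s, u τ) - ∫ τ in t..s, u₀ τ) := by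
      rw [hprim s hs]; abel
    simp only [e]
    refine (norm_add_le _ _).trans ?_
    linarith
  · filter_upwards [ae_restrict_of_ae (primitive_hasDerivAt hum huM t y),
      ae_restrict_mem measurableSet_Icc] with s h1 hs
    exact ⟨u s, h1, (hu s hs).1⟩

/-- Short trajectories with prescribed approximate velocity, forward or backward in time. -/
theorem StandingHyp.exists_short_trajectory (h : StandingHyp F) {x₁ v₀ : Rn n} (hv₀ : v₀ ∈ F x₁) :
    ∃ C : ℝ, 0 < C ∧ ∃ ρ : ℝ, 0 < ρ ∧ ∀ r t : ℝ, ∀ y : Rn n, |t - r| ≤ ρ → ‖y - x₁‖ ≤ ρ →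
      ∃ z : ℝ → Rn n, ∃ K : NNReal, z r = y ∧ LipschitzWith K z ∧
        ‖z t - (y + (t - r) • v₀)‖ ≤ C * |t - r| * (|t - r| + ‖y - x₁‖) ∧
        ∀ᵐ s ∂(volume.restrict (uIcc r t)), ∃ v ∈ F (z s), HasDerivAt z v s := by
  obtain ⟨c, hc0, hc⟩ := h.exists_lipschitz_ball (‖x₁‖ + 1)
  obtain ⟨M, hM0, hM⟩ := h.exists_bound_ball (‖x₁‖ + 1)
  have hx₁ : x₁ ∈ Metric.closedBall (0 : Rn n) (‖x₁‖ + 1) := by simp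
  set E := Real.exp (2 * c * 1)
  -- The radius leaves `1/2` for `‖y - x₁‖` and `1/2` for the distance travelled at speed `M`, so
  -- `z` stays in the ball of radius `‖x₁‖ + 1`, where the truncation by `ballProj` is inactive.
  refine ⟨4 * (c * (M + 1)) * E, by positivity, min 1 (1 / (2 * (M + 1))), by positivity,
    fun r t y hrt hy => ?_⟩
  have hrt1 : |t - r| ≤ 1 := hrt.trans (min_le_left _ _)
  have hrtM : M * |t - r| ≤ 1 / 2 := by
    have := hrt.trans (min_le_right _ _)
    rw [le_div_iff₀ (by positivity)] at this
    nlinarith [abs_nonneg (t - r)]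
  have hyM : ‖y - x₁‖ ≤ 1 / 2 := by
    have := hy.trans (min_le_right _ _)
    refine this.trans ?_
    rw [div_le_div_iff₀ (by positivity) (by positivity)]
    linarith
  have hv₀M : ‖v₀‖ ≤ M := hM x₁ hx₁ v₀ hv₀
  have hπ := isSelector_cproj h (R := ‖x₁‖ + 1) (by positivity) hc0 hc hM
    (p := fun _ => 0) (a := min r t) (b := max r t) fun _ _ => rfl
  have hr : r ∈ Icc (min r t) (max r t) := ⟨min_le_left _ _, le_max_left _ _⟩
  have ht : t ∈ Icc (min r t) (max r t) := ⟨min_le_right _ _, le_max_right _ _⟩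
  have hlen : max r t - min r t = |t - r| := by rw [max_sub_min_eq_abs, abs_sub_comm]
  have hdist : ∀ s ∈ Icc (min r t) (max r t), |s - r| ≤ |t - r| := fun s hs => by
    rw [← hlen, abs_le]
    constructor <;> linarith [hs.1, hs.2, hr.1, hr.2]
  obtain ⟨u, hum, huM, hu⟩ := exists_selection_solution
    (η := c * ((M + 1) * (|t - r| + ‖y - x₁‖))) hc0 hr
    (u₀ := fun _ => v₀) measurable_const (fun _ => hv₀M) y
    (fun s _ => hπ.bound s) (fun s _ => hπ.lip s) (fun s _ => hπ.cont s) hπ.meas (by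
      intro s hs
      have e : cproj (F (ballProj (‖x₁‖ + 1) x₁)) v₀ = v₀ := by
        rw [ballProj_eq_self hx₁, cproj_eq_self (h.compact _).isClosed (h.convex _) hv₀]
      have h1 := hπ.lip s x₁ (y + ∫ _ in r..s, v₀) v₀
      simp only [e] at h1
      refine h1.trans ?_
      have e2 : (y + ∫ _ in r..s, v₀) - x₁ = (y - x₁) + (s - r) • v₀ := by
        rw [intervalIntegral.integral_const]; abel
      have h2 : ‖(y - x₁) + (s - r) • v₀‖ ≤ ‖y - x₁‖ + |t - r| * M := by
        refine (norm_add_le _ _).trans ?_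
        rw [norm_smul, Real.norm_eq_abs]
        exact add_le_add le_rfl (mul_le_mul (hdist s hs) hv₀M (norm_nonneg _) (abs_nonneg _))
      rw [e2]
      gcongr
      nlinarith [norm_nonneg (y - x₁), abs_nonneg (t - r)])
  have hzball : ∀ s ∈ Icc (min r t) (max r t),
      y + ∫ τ in r..s, u τ ∈ Metric.closedBall (0 : Rn n) (‖x₁‖ + 1) := by
    intro s hs
    have h1 : ‖∫ τ in r..s, u τ‖ ≤ M * |s - r| :=
      intervalIntegral.norm_integral_le_of_norm_le_const fun x _ => huM x
    have h2 : M * |s - r| ≤ M * |t - r| := mul_le_mul_of_nonneg_left (hdist s hs) hM0.le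
    rw [mem_closedBall_zero_iff]
    have e : y + ∫ τ in r..s, u τ = x₁ + (y - x₁) + ∫ τ in r..s, u τ := by abel
    rw [e]
    refine (norm_add₃_le ..).trans ?_
    linarith
  refine ⟨fun s => y + ∫ τ in r..s, u τ, M.toNNReal, by simp, primitive_lipschitz hum huM r y,
    ?_, ?_⟩
  · have h1 : ‖∫ τ in r..t, (u τ - v₀)‖ ≤
        4 * (c * ((M + 1) * (|t - r| + ‖y - x₁‖))) * E * |t - r| :=
      intervalIntegral.norm_integral_le_of_norm_le_const fun s hs => by
        refine (hu s (uIoc_subset_uIcc hs)).2.trans ?_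
        rw [hlen]
        have hE : Real.exp (2 * c * |t - r|) ≤ E := Real.exp_le_exp.2 (by gcongr)
        gcongr
    rw [intervalIntegral.integral_sub (intervalIntegrable_of_bound hum huM _ _)
      intervalIntegrable_const, intervalIntegral.integral_const] at h1
    rw [add_sub_add_left_eq_sub]
    calc _ ≤ _ := h1
      _ = _ := by ring
  · filter_upwards [ae_restrict_of_ae (primitive_hasDerivAt hum huM r y),
      ae_restrict_mem measurableSet_uIcc] with s h1 hs
    exact ⟨u s, (hπ.fixed s hs _ (hzball s hs) _ (hu s hs).1).1, h1⟩

end Selectors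

end Mayer

namespace Mayer
variable {n : ℕ} {F : Rn n → Set (Rn n)}

/-! ### Trajectories -/

theorem IsTrajectory.of_lipschitz {a b : ℝ} {z : ℝ → Rn n} {K : NNReal}
    (hz : LipschitzOnWith K z (uIcc a b))
    (hd : ∀ᵐ s ∂(volume.restrict (Icc a b)), ∃ v ∈ F (z s), HasDerivAt z v s) :
    IsTrajectory F b a (z a) z :=
  ⟨hz.absolutelyContinuousOnInterval, hd, rfl⟩

theorem IsTrajectory.restrict {a b c d : ℝ} {x : Rn n} {z : ℝ → Rn n}
    (hz : IsTrajectory F b a x z) (hac : a ≤ c) (hcd : c ≤ d) (hdb : d ≤ b) :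
    IsTrajectory F d c (z c) z :=
  ⟨ac_mono hac hcd hdb hz.ac, ae_Icc_mono hz.inclusion (Icc_subset_Icc hac hdb), rfl⟩

/-- Gronwall for `1 + ‖z‖²`, whose derivative is at most `2γ‖z‖(1 + ‖z‖) ≤ 4γ(1 + ‖z‖²)`. -/
theorem IsTrajectory.sq_bound {γ : ℝ} (hγ : 0 < γ) (hF : ∀ x, ∀ v ∈ F x, ‖v‖ ≤ γ * (1 + ‖x‖))
    {a b : ℝ} (hab : a ≤ b) {x : Rn n} {z : ℝ → Rn n} (hz : IsTrajectory F b a x z) :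
    ‖z b‖ ^ 2 ≤ (1 + ‖x‖ ^ 2) * Real.exp (4 * γ * (b - a)) := by
  have h := ac_gronwall (f := fun s => 1 + inner ℝ (z s) (z s)) (K := 4 * γ) hab
    ((ac_const (1 : ℝ) a b).add (ac_inner hz.ac hz.ac)) (by
      filter_upwards [hz.inclusion] with s ⟨v, hv, hd⟩
      refine ⟨_, (hd.inner ℝ hd).const_add 1, ?_⟩
      rw [real_inner_comm, real_inner_self_eq_norm_sq, ← two_mul]
      have h1 := real_inner_le_norm (z s) v
      have h2 := mul_le_mul_of_nonneg_left (hF _ v hv) (norm_nonneg (z s))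
      rw [real_inner_comm] at h1
      nlinarith [sq_nonneg (‖z s‖ - 1), norm_nonneg (z s)])
  rw [real_inner_self_eq_norm_sq, real_inner_self_eq_norm_sq, hz.initial] at h
  linarith

theorem StandingHyp.exists_uniform_bound (h : StandingHyp F) (R₀ L : ℝ) :
    ∃ R : ℝ, 0 < R ∧ ∀ a b : ℝ, b - a ≤ L → ∀ x : Rn n, ‖x‖ ≤ R₀ → ∀ z : ℝ → Rn n,
      IsTrajectory F b a x z → ∀ s ∈ Icc a b, ‖z s‖ ≤ R := by
  obtain ⟨γ, hγ, hF⟩ := h.linearGrowth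
  refine ⟨Real.sqrt ((1 + R₀ ^ 2) * Real.exp (4 * γ * L)), by positivity,
    fun a b hL x hx z hz s hs => Real.le_sqrt_of_sq_le ?_⟩
  have h1 := (hz.restrict le_rfl hs.1 hs.2).sq_bound hγ hF hs.1
  rw [hz.initial] at h1
  refine h1.trans ?_
  have : s - a ≤ L := by linarith [hs.2]
  gcongr

theorem IsTrajectory.norm_sub_le {M a b : ℝ} (hab : a ≤ b) {x : Rn n} {z : ℝ → Rn n}
    (hz : IsTrajectory F b a x z) (hM : ∀ s ∈ Icc a b, ∀ v ∈ F (z s), ‖v‖ ≤ M) :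
    ‖z b - z a‖ ≤ M * (b - a) :=
  ac_norm_sub_le hab hz.ac (by
    filter_upwards [hz.inclusion, ae_restrict_mem measurableSet_Icc] with s ⟨v, hv, hd⟩ hs
    exact ⟨v, hd, hM s hs v hv⟩)

theorem StandingHyp.exists_lipschitzOnWith (h : StandingHyp F) {a b : ℝ} {x : Rn n} {z : ℝ → Rn n}
    (hz : IsTrajectory F b a x z) : ∃ K : NNReal, LipschitzOnWith K z (Icc a b) := by
  obtain ⟨R, hR0, hR⟩ := h.exists_uniform_bound ‖x‖ (b - a)
  obtain ⟨M, hM0, hM⟩ := h.exists_bound_ball R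
  have hzR := hR a b le_rfl x le_rfl z hz
  have key : ∀ s ∈ Icc a b, ∀ r ∈ Icc a b, s ≤ r → ‖z r - z s‖ ≤ M * (r - s) :=
    fun s hs r hr hsr => (hz.restrict hs.1 hsr hr.2).norm_sub_le hsr fun q hq =>
      hM _ (by simpa using hzR q ⟨hs.1.trans hq.1, hq.2.trans hr.2⟩)
  refine ⟨M.toNNReal, LipschitzOnWith.of_dist_le_mul fun s hs r hr => ?_⟩
  rw [Real.coe_toNNReal _ hM0.le, dist_eq_norm, Real.dist_eq]
  rcases le_total s r with hsr | hsr
  · rw [norm_sub_rev, abs_sub_comm, abs_of_nonneg (sub_nonneg.2 hsr)]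
    exact key s hs r hr hsr
  · rw [abs_of_nonneg (sub_nonneg.2 hsr)]
    exact key r hr s hs hsr

/-- Trajectories are Lipschitz by the a priori bound, so absolute continuity of the glued arc
reduces to adding Lipschitz estimates across the junction. -/
theorem StandingHyp.exists_concat (h : StandingHyp F) {a m b : ℝ} (ham : a ≤ m) (hmb : m ≤ b)
    {x : Rn n} {z₁ z₂ : ℝ → Rn n} (h1 : IsTrajectory F m a x z₁)
    (h2 : IsTrajectory F b m (z₁ m) z₂) :
    ∃ z : ℝ → Rn n, IsTrajectory F b a x z ∧ z b = z₂ b := by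
  obtain ⟨K₁, hK₁⟩ := h.exists_lipschitzOnWith h1
  obtain ⟨K₂, hK₂⟩ := h.exists_lipschitzOnWith h2
  set z : ℝ → Rn n := fun s => if s ≤ m then z₁ s else z₂ s with hz
  have hzl : ∀ s, s ≤ m → z s = z₁ s := fun s hs => by simp [hz, hs]
  have hzr : ∀ s, m ≤ s → z s = z₂ s := fun s hs => by
    rcases hs.eq_or_lt with rfl | hlt
    · rw [hzl m le_rfl, h2.initial]
    · simp [hz, hlt]
  refine ⟨z, ⟨?_, ?_, by rw [hzl a ham, h1.initial]⟩, hzr b hmb⟩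
  · have key : ∀ s ∈ Icc a b, ∀ r ∈ Icc a b, s ≤ r → dist (z s) (z r) ≤ (K₁ + K₂) * (r - s) := by
      intro s hs r hr hsr
      have hK₁0 := K₁.2
      have hK₂0 := K₂.2
      rcases le_total r m with hrm | hrm
      · have := hK₁.dist_le_mul s ⟨hs.1, hsr.trans hrm⟩ r ⟨hr.1, hrm⟩
        rw [Real.dist_eq, abs_sub_comm, abs_of_nonneg (sub_nonneg.2 hsr)] at this
        rw [hzl s (hsr.trans hrm), hzl r hrm]
        exact this.trans (mul_le_mul_of_nonneg_right (le_add_of_nonneg_right hK₂0)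
          (sub_nonneg.2 hsr))
      rcases le_total s m with hsm | hsm
      · have e1 := hK₁.dist_le_mul s ⟨hs.1, hsm⟩ m ⟨ham, le_rfl⟩
        have e2 := hK₂.dist_le_mul m ⟨le_rfl, hmb⟩ r ⟨hrm, hr.2⟩
        rw [Real.dist_eq, abs_sub_comm, abs_of_nonneg (sub_nonneg.2 hsm)] at e1
        rw [Real.dist_eq, abs_sub_comm, abs_of_nonneg (sub_nonneg.2 hrm), h2.initial] at e2
        rw [hzl s hsm, hzr r hrm]
        refine (dist_triangle _ (z₁ m) _).trans ((add_le_add e1 e2).trans ?_)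
        have e3 := mul_nonneg hK₁0 (sub_nonneg.2 hrm)
        have e4 := mul_nonneg hK₂0 (sub_nonneg.2 hsm)
        simp only [NNReal.val_eq_coe] at e3 e4
        linarith
      · have := hK₂.dist_le_mul s ⟨hsm, hs.2⟩ r ⟨hrm, hr.2⟩
        rw [Real.dist_eq, abs_sub_comm, abs_of_nonneg (sub_nonneg.2 hsr)] at this
        rw [hzr s hsm, hzr r hrm]
        exact this.trans (mul_le_mul_of_nonneg_right (le_add_of_nonneg_left hK₁0)
          (sub_nonneg.2 hsr))
    have hl : LipschitzOnWith (K₁ + K₂) z (uIcc a b) := by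
      rw [uIcc_of_le (ham.trans hmb)]
      refine LipschitzOnWith.of_dist_le_mul fun s hs r hr => ?_
      rw [Real.dist_eq, NNReal.coe_add]
      rcases le_total s r with hsr | hsr
      · rw [abs_sub_comm, abs_of_nonneg (sub_nonneg.2 hsr)]
        exact key s hs r hr hsr
      · rw [abs_of_nonneg (sub_nonneg.2 hsr), dist_comm]
        exact key r hr s hs hsr
    exact hl.absolutelyContinuousOnInterval
  · rw [ae_restrict_iff' measurableSet_Icc]
    have hm : ∀ᵐ s : ℝ, s ≠ m := by simp [ae_iff, measure_singleton]
    filter_upwards [(ae_restrict_iff' measurableSet_Icc).1 h1.inclusion,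
      (ae_restrict_iff' measurableSet_Icc).1 h2.inclusion, hm] with s e1 e2 hsm hs
    rcases lt_or_gt_of_ne hsm with hlt | hgt
    · obtain ⟨v, hv, hd⟩ := e1 ⟨hs.1, hlt.le⟩
      refine ⟨v, by rwa [hzl s hlt.le], hd.congr_of_eventuallyEq ?_⟩
      filter_upwards [Iio_mem_nhds hlt] with r hr
      exact hzl r (le_of_lt hr)
    · obtain ⟨v, hv, hd⟩ := e2 ⟨hgt.le, hs.2⟩
      refine ⟨v, by rwa [hzr s hgt.le], hd.congr_of_eventuallyEq ?_⟩
      filter_upwards [Ioi_mem_nhds hgt] with r hr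
      exact hzr r (le_of_lt hr)

/-- First-order expansion of short trajectories in a fixed direction. -/
theorem StandingHyp.exists_displacement (h : StandingHyp F) (x₁ q : Rn n) :
    ∃ C : ℝ, 0 < C ∧ ∀ a b : ℝ, a ≤ b → b - a ≤ 1 → ∀ y : Rn n, ‖y - x₁‖ ≤ 1 → ∀ z : ℝ → Rn n,
      IsTrajectory F b a y z → ‖z b - y‖ ≤ C * (b - a) ∧
      inner ℝ q (z b - y) ≤ (b - a) * (hamiltonian F x₁ q + C * (b - a + ‖y - x₁‖)) := by
  obtain ⟨R, hR0, hR⟩ := h.exists_uniform_bound (‖x₁‖ + 1) 1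
  obtain ⟨M, hM0, hM⟩ := h.exists_bound_ball (R + ‖x₁‖)
  obtain ⟨c, hc0, hc⟩ := h.exists_lipschitz_ball (R + ‖x₁‖)
  refine ⟨M + c * (M + 1) * ‖q‖, by positivity, fun a b hab hL y hy z hz => ?_⟩
  have hy' : ‖y‖ ≤ ‖x₁‖ + 1 := by
    have := norm_le_norm_add_norm_sub' y x₁
    linarith
  have hzR : ∀ s ∈ Icc a b, z s ∈ Metric.closedBall (0 : Rn n) (R + ‖x₁‖) := fun s hs => by
    rw [mem_closedBall_zero_iff]
    linarith [hR a b hL y hy' z hz s hs, norm_nonneg x₁]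
  have hx₁ : x₁ ∈ Metric.closedBall (0 : Rn n) (R + ‖x₁‖) := by
    rw [mem_closedBall_zero_iff]; linarith
  have hdisp : ∀ s ∈ Icc a b, ‖z s - y‖ ≤ M * (b - a) := fun s hs => by
    have h1 := (hz.restrict le_rfl hs.1 hs.2).norm_sub_le hs.1 fun r hr =>
      hM _ (hzR r ⟨hr.1, hr.2.trans hs.2⟩)
    rw [hz.initial] at h1
    refine h1.trans ?_
    have := hs.2
    gcongr
  have hba : 0 ≤ b - a := sub_nonneg.2 hab
  constructor
  · refine (hdisp b ⟨hab, le_rfl⟩).trans (mul_le_mul_of_nonneg_right ?_ hba)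
    linarith [show 0 ≤ c * (M + 1) * ‖q‖ by positivity]
  · have h1 := ac_sub_le (f := fun s => inner ℝ q (z s)) (m := hamiltonian F x₁ q +
        (M + c * (M + 1) * ‖q‖) * (b - a + ‖y - x₁‖)) hab (ac_inner (ac_const q a b) hz.ac) (by
      filter_upwards [hz.inclusion, ae_restrict_mem measurableSet_Icc] with s ⟨v, hv, hd⟩ hs
      refine ⟨_, (hasDerivAt_const s q).inner ℝ hd, ?_⟩
      simp only [inner_zero_left, add_zero]
      have e1 := h.inner_le_hamiltonian q hv
      rw [real_inner_comm] at e1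
      have e2 := hamiltonian_sub_le h hc (hzR s hs) hx₁ q
      have e3 : ‖z s - x₁‖ ≤ M * (b - a) + ‖y - x₁‖ :=
        (norm_sub_le_norm_sub_add_norm_sub _ y _).trans (by gcongr; exact hdisp s hs)
      have e4 : c * ‖z s - x₁‖ * ‖q‖ ≤ c * (M * (b - a) + ‖y - x₁‖) * ‖q‖ := by gcongr
      have e5 : c * (M * (b - a) + ‖y - x₁‖) * ‖q‖ ≤
          c * ((M + 1) * (b - a + ‖y - x₁‖)) * ‖q‖ := by
        gcongr
        nlinarith [norm_nonneg (y - x₁)]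
      have e6 : 0 ≤ M * (b - a + ‖y - x₁‖) := by positivity
      linarith)
    rw [← inner_sub_right, hz.initial, mul_comm] at h1
    exact h1

/-! ### The value function -/

section Value
variable {φ : Rn n → ℝ}

theorem StandingHyp.value_le (h : StandingHyp F) (hφ : Continuous φ) {T t : ℝ} (ht : t ≤ T)
    {x : Rn n} {y : ℝ → Rn n} (hy : IsTrajectory F T t x y) : value F φ T t x ≤ φ (y T) := by
  obtain ⟨R, hR0, hR⟩ := h.exists_uniform_bound ‖x‖ (T - t)
  obtain ⟨m, hm⟩ := ((isCompact_closedBall (0 : Rn n) R).image hφ).bddBelow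
  refine csInf_le ⟨m, ?_⟩ ⟨y, hy, rfl⟩
  rintro _ ⟨z, hz, rfl⟩
  exact hm (mem_image_of_mem _ (by simpa using hR t T le_rfl x le_rfl z hz T ⟨ht, le_rfl⟩))

/-- Without `hne` the infimum could be the default value `0` of an empty set, so each lower bound on
the value must come with a trajectory. -/
theorem le_value {T t m : ℝ} {x : Rn n} (hne : ∃ y, IsTrajectory F T t x y)
    (hm : ∀ y, IsTrajectory F T t x y → m ≤ φ (y T)) : m ≤ value F φ T t x := by
  obtain ⟨y, hy⟩ := hne
  refine le_csInf ⟨_, y, hy, rfl⟩ ?_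
  rintro _ ⟨z, hz, rfl⟩
  exact hm z hz

/-- Dynamic programming: the value is nondecreasing along trajectories. -/
theorem StandingHyp.value_le_value (h : StandingHyp F) (hφ : Continuous φ) {T t m : ℝ}
    (htm : t ≤ m) (hmT : m ≤ T) {x : Rn n} {z : ℝ → Rn n} (hz : IsTrajectory F m t x z)
    (hne : ∃ y, IsTrajectory F T m (z m) y) : value F φ T t x ≤ value F φ T m (z m) := by
  refine le_value hne fun y hy => ?_
  obtain ⟨q, hq, hqT⟩ := h.exists_concat htm hmT hz hy
  rw [← hqT]
  exact h.value_le hφ (htm.trans hmT) hq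

/-- Principle of optimality: a better tail from `x t` could be glued to the initial piece of `x`. -/
theorem StandingHyp.value_eq_of_optimal (h : StandingHyp F) (hφ : Continuous φ) {T t₀ : ℝ}
    {x₀ : Rn n} {x : ℝ → Rn n} (hx : IsOptimal F φ T t₀ x₀ x) {t : ℝ} (ht : t ∈ Icc t₀ T) :
    value F φ T t (x t) = φ (x T) := by
  have h1 := hx.1.restrict ht.1 ht.2 le_rfl
  refine le_antisymm (h.value_le hφ ht.2 h1) (le_value ⟨x, h1⟩ fun y hy => ?_)
  obtain ⟨q, hq, hqT⟩ := h.exists_concat ht.1 ht.2 (hx.1.restrict le_rfl ht.1 ht.2) hy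
  rw [← hqT]
  rw [hx.1.initial] at hq
  exact hx.2 q hq

end Value

/-! ### Transport of perturbations along an extremal -/

/-- Since `‖ṗ‖ ≤ c‖p‖`, Gronwall for `‖p‖²`, forward and backward, spreads a single zero to the
whole interval. -/
theorem adjoint_zero_or_ne_zero (h : StandingHyp F) {T t₀ : ℝ} {x p : ℝ → Rn n} {R : ℝ}
    (hxR : ∀ s ∈ Icc t₀ T, ‖x s‖ < R) (hsys : SolvesHamiltonianSystem F T t₀ x p) :
    (∀ s ∈ Icc t₀ T, p s = 0) ∨ ∀ s ∈ Icc t₀ T, p s ≠ 0 := by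
  obtain ⟨c, hc0, hc⟩ := h.exists_lipschitz_ball R
  by_cases hall : ∀ s ∈ Icc t₀ T, p s ≠ 0
  · exact Or.inr hall
  push Not at hall
  obtain ⟨r, hr, hpr⟩ := hall
  refine Or.inl fun s hs => ?_
  have hd : ∀ᵐ s ∂(volume.restrict (Icc t₀ T)), ∃ v : ℝ,
      HasDerivAt (fun s => inner ℝ (p s) (p s)) v s ∧ |v| ≤ 2 * c * inner ℝ (p s) (p s) := by
    filter_upwards [hsys.p_eq, ae_restrict_mem measurableSet_Icc] with s ⟨w, hw, hd⟩ hs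
    refine ⟨_, hd.inner ℝ hd, ?_⟩
    have h1 := norm_le_of_mem_frechetSub_hamiltonian h hc0 hc (by simpa using hxR s hs) hw
    rw [norm_neg] at h1
    rw [real_inner_comm, ← two_mul, abs_mul, abs_two, real_inner_self_eq_norm_sq]
    have h2 := abs_real_inner_le_norm w (p s)
    have h3 := mul_le_mul_of_nonneg_right h1 (norm_nonneg (p s))
    nlinarith
  have hac := ac_inner hsys.ac_p hsys.ac_p
  have hle : inner ℝ (p s) (p s) ≤ (0 : ℝ) := by
    rcases le_total r s with hrs | hsr
    · have h1 := ac_gronwall (K := 2 * c) hrs (ac_mono hr.1 hrs hs.2 hac) (by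
        filter_upwards [ae_Icc_mono hd (Icc_subset_Icc hr.1 hs.2)] with q ⟨v, hv, hb⟩
        exact ⟨v, hv, (le_abs_self v).trans hb⟩)
      rwa [hpr, inner_zero_left, zero_mul] at h1
    · have h1 := ac_gronwall (K := -(2 * c)) hsr (ac_mono hs.1 hsr hr.2 hac).neg (by
        filter_upwards [ae_Icc_mono hd (Icc_subset_Icc hs.1 hr.2)] with q ⟨v, hv, hb⟩
        refine ⟨-v, hv.neg, ?_⟩
        rw [Pi.neg_apply]
        linarith [neg_le_abs v])
      simp only [Pi.neg_apply, hpr, inner_zero_left, neg_zero] at h1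
      have := Real.exp_pos (-(2 * c) * (r - s))
      nlinarith
  rw [real_inner_self_eq_norm_sq] at hle
  have : ‖p s‖ = 0 := by nlinarith [norm_nonneg (p s)]
  exact norm_eq_zero.1 this

/-- If `p` has no zero, `ẋ ∈ ∂ₚ⁻H` forces `ẋ = ∇ₚH(x,p)` and the gradient selector applies. If `p`
vanishes identically, every velocity is maximising and projection onto `F` suffices. -/
theorem exists_selector_of_extremal (h : StandingHyp F) (hH : HamiltonianHyp F) {T t₀ : ℝ}
    (ht₀ : t₀ ≤ T) {x₀ : Rn n} {x p : ℝ → Rn n} {R : ℝ} (hR : 0 < R)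
    (hxR : ∀ s ∈ Icc t₀ T, ‖x s‖ < R) (hx : IsTrajectory F T t₀ x₀ x)
    (hsys : SolvesHamiltonianSystem F T t₀ x p) :
    ∃ c M : ℝ, 0 < c ∧ ∃ π, IsSelector F R c M p t₀ T π ∧
      ∀ᵐ s ∂(volume.restrict (Icc t₀ T)), ∃ v, HasDerivAt x v s ∧ v = π s (x s) v := by
  obtain ⟨M, hM0, hM⟩ := h.exists_bound_ball R
  have hxball : ∀ s ∈ Icc t₀ T, x s ∈ Metric.closedBall (0 : Rn n) R := fun s hs => by
    simpa using (hxR s hs).le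
  rcases adjoint_zero_or_ne_zero h hxR hsys with hp | hp
  · obtain ⟨c, hc0, hc⟩ := h.exists_lipschitz_ball R
    refine ⟨c, M, hc0, _, isSelector_cproj h hR.le hc0 hc hM hp, ?_⟩
    filter_upwards [hx.inclusion, ae_restrict_mem measurableSet_Icc] with s ⟨v, hv, hd⟩ hs
    refine ⟨v, hd, ?_⟩
    rw [ballProj_eq_self (hxball s hs), cproj_eq_self (h.compact _).isClosed (h.convex _) hv]
  · obtain ⟨k, hk⟩ := hH.lipschitz_gradient R hR
    have hpc := hsys.ac_p.continuousOn
    rw [uIcc_of_le ht₀] at hpc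
    refine ⟨k + 1, M, by positivity, _, isSelector_gradient h hH hR hk hM ht₀ hpc hp, ?_⟩
    filter_upwards [hsys.x_eq, ae_restrict_mem measurableSet_Icc] with s ⟨v, hv, hd⟩ hs
    refine ⟨v, hd, ?_⟩
    rw [ballProj_eq_self (hxball s hs), IccExtend_of_mem _ _ hs]
    exact eq_gradient_of_mem_frechetSub hv
      (hH.differentiable R hR _ (hxball s hs) _ (hp s hs))

/-- Both `x` and `z` follow the selector, so `⟨p, ż - ẋ⟩ = H(z,p) - H(x,p)` almost everywhere;
semiconvexity bounds this below by `⟨-ṗ, z - x⟩` minus a quadratic error. -/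
theorem exists_transport (h : StandingHyp F) (hH : HamiltonianHyp F) {T t₀ : ℝ}
    (ht₀ : t₀ ≤ T) {x₀ : Rn n} {x p : ℝ → Rn n} (hx : IsTrajectory F T t₀ x₀ x)
    (hsys : SolvesHamiltonianSystem F T t₀ x p) :
    ∃ C : ℝ, 0 < C ∧ ∃ ρ : ℝ, 0 < ρ ∧ ∀ t ∈ Icc t₀ T, ∀ y : Rn n, ‖y - x t‖ ≤ ρ →
      ∃ z : ℝ → Rn n, z t = y ∧ IsTrajectory F T t₀ (z t₀) z ∧
        (∀ s ∈ Icc t₀ T, ‖z s - x s‖ ≤ C * ‖y - x t‖) ∧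
        ∀ s ∈ Icc t₀ T, ∀ r ∈ Icc t₀ T, s ≤ r →
          inner ℝ (p s) (z s - x s) - C * ‖y - x t‖ ^ 2 ≤ inner ℝ (p r) (z r - x r) := by
  obtain ⟨R₁, hR₁0, hR₁⟩ := h.exists_uniform_bound ‖x₀‖ (T - t₀)
  have hxR₁ := hR₁ t₀ T le_rfl x₀ le_rfl x hx
  have hxR : ∀ s ∈ Icc t₀ T, ‖x s‖ < R₁ + 1 := fun s hs => by linarith [hxR₁ s hs]
  have hxball : ∀ s ∈ Icc t₀ T, x s ∈ Metric.closedBall (0 : Rn n) (R₁ + 1) := fun s hs => by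
    simpa using (hxR s hs).le
  obtain ⟨c, M, hc0, π, hπ, hxπ⟩ :=
    exists_selector_of_extremal h hH ht₀ (by linarith : 0 < R₁ + 1) hxR hx hsys
  obtain ⟨C, hC0, hC⟩ := hπ.exists_perturbed hc0 ht₀ hx.ac hxπ
  obtain ⟨k, hk0, hk⟩ := hH.semiconvex (R₁ + 1) (by linarith)
  obtain ⟨P, hP⟩ := hsys.ac_p.exists_bound
  rw [uIcc_of_le ht₀] at hP
  have hP0 : 0 ≤ P := (norm_nonneg _).trans (hP t₀ ⟨le_rfl, ht₀⟩)
  have hTt : 0 ≤ T - t₀ := sub_nonneg.2 ht₀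
  -- The second summand is the semiconvexity error integrated over `[t₀,T]`. The radius `1 / C`
  -- keeps `z` within distance `1` of `x`, hence in the ball of radius `R₁ + 1`.
  refine ⟨C + k * P / 2 * C ^ 2 * (T - t₀), by positivity, 1 / C, by positivity,
    fun t ht y hy => ?_⟩
  obtain ⟨z, K, hzt, hzK, hzx, hzd⟩ := hC t ht y
  have hd1 : C * ‖y - x t‖ ≤ 1 := by
    rw [le_div_iff₀ hC0] at hy; linarith
  have hzball : ∀ s ∈ Icc t₀ T, z s ∈ Metric.closedBall (0 : Rn n) (R₁ + 1) := fun s hs => by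
    rw [mem_closedBall_zero_iff]
    have := norm_le_norm_add_norm_sub' (z s) (x s)
    linarith [hzx s hs, hxR₁ s hs]
  have hzac : AbsolutelyContinuousOnInterval z t₀ T :=
    hzK.lipschitzOnWith.absolutelyContinuousOnInterval
  refine ⟨z, hzt, ⟨hzac, ?_, rfl⟩, fun s hs => (hzx s hs).trans ?_, fun s hs r hr hsr => ?_⟩
  · filter_upwards [hzd, ae_restrict_mem measurableSet_Icc] with s ⟨v, hv, hvπ⟩ hs
    exact ⟨v, (hπ.fixed s hs _ (hzball s hs) v hvπ).1, hv⟩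
  · exact mul_le_mul_of_nonneg_right (le_add_of_nonneg_right (by positivity)) (norm_nonneg _)
  · have hθ : AbsolutelyContinuousOnInterval (fun s => inner ℝ (p s) (z s - x s)) t₀ T :=
      ac_inner hsys.ac_p (hzac.sub hx.ac)
    have hder : ∀ᵐ s ∂(volume.restrict (Icc t₀ T)), ∃ v : ℝ,
        HasDerivAt (-fun s => inner ℝ (p s) (z s - x s)) v s ∧
          v ≤ k * P / 2 * (C * ‖y - x t‖) ^ 2 := by
      filter_upwards [hzd, hxπ, hsys.p_eq, ae_restrict_mem measurableSet_Icc] with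
        s ⟨vz, hvz, hvzπ⟩ ⟨vx, hvx, hvxπ⟩ ⟨w, hw, hdw⟩ hs
      refine ⟨_, (hdw.inner ℝ (hvz.sub hvx)).neg, ?_⟩
      have e1 := (hπ.fixed s hs _ (hzball s hs) vz hvzπ).2
      have e2 := (hπ.fixed s hs _ (hxball s hs) vx hvxπ).2
      have e3 := hamiltonian_lower_bound h hk (hxball s hs) (hzball s hs) hw
      rw [inner_neg_left] at e3
      rw [inner_sub_right, real_inner_comm, e1, real_inner_comm vx (p s), e2]
      have e4 : k * ‖p s‖ / 2 * ‖z s - x s‖ ^ 2 ≤ k * P / 2 * (C * ‖y - x t‖) ^ 2 := by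
        gcongr
        · exact hP s hs
        · exact hzx s hs
      simp only [Pi.sub_apply]
      linarith
    have h1 := ac_sub_le hsr (ac_mono hs.1 hsr hr.2 hθ).neg
      (ae_Icc_mono hder (Icc_subset_Icc hs.1 hr.2))
    simp only [Pi.neg_apply] at h1
    have h2 : k * P / 2 * (C * ‖y - x t‖) ^ 2 * (r - s) ≤
        k * P / 2 * (C * ‖y - x t‖) ^ 2 * (T - t₀) := by
      have := hs.1
      have := hr.2
      gcongr
    have h3 : 0 ≤ C * ‖y - x t‖ ^ 2 := by positivity
    linarith

end Mayer

namespace Mayer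
variable {n : ℕ} {F : Rn n → Set (Rn n)} {φ : Rn n → ℝ}

/-! ### Sensitivity relations -/

section Sensitivity
variable {T t₀ : ℝ} {x₀ : Rn n} {x p : ℝ → Rn n}

theorem exists_trajectory_near (h : StandingHyp F) (hH : HamiltonianHyp F) (ht₀ : t₀ ≤ T)
    (hx : IsTrajectory F T t₀ x₀ x) (hsys : SolvesHamiltonianSystem F T t₀ x p) :
    ∃ ρ : ℝ, 0 < ρ ∧ ∀ t ∈ Icc t₀ T, ∀ y : Rn n, ‖y - x t‖ ≤ ρ →
      ∃ z, IsTrajectory F T t y z := by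
  obtain ⟨C, hC0, ρ, hρ0, hC⟩ := exists_transport h hH ht₀ hx hsys
  refine ⟨ρ, hρ0, fun t ht y hy => ?_⟩
  obtain ⟨z, hzt, hz, -⟩ := hC t ht y hy
  rw [← hzt]
  exact ⟨z, hz.restrict ht.1 ht.2 le_rfl⟩

/-- Backward propagation of the superdifferential, uniformly in time. -/
theorem value_le_near (h : StandingHyp F) (hH : HamiltonianHyp F) (hφ : Continuous φ)
    (ht₀ : t₀ ≤ T) (hx : IsTrajectory F T t₀ x₀ x) (hsys : SolvesHamiltonianSystem F T t₀ x p)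
    (hpT : -p T ∈ frechetSuper φ (x T)) {ε : ℝ} (hε : 0 < ε) :
    ∃ δ : ℝ, 0 < δ ∧ ∀ t ∈ Icc t₀ T, ∀ y : Rn n, ‖y - x t‖ ≤ δ →
      value F φ T t y ≤ φ (x T) - inner ℝ (p t) (y - x t) + ε * ‖y - x t‖ := by
  obtain ⟨C, hC0, ρ, hρ0, hC⟩ := exists_transport h hH ht₀ hx hsys
  obtain ⟨δ₁, hδ₁, hsup⟩ := Metric.eventually_nhds_iff.1
    (eventually_of_mem_frechetSuper hpT (show 0 < ε / (2 * C) by positivity))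
  -- Respectively: transport is available, `z T` lies where the supergradient inequality holds, and
  -- the quadratic transport error is at most `ε / 2 * ‖y - x t‖`.
  refine ⟨min ρ (min (δ₁ / (2 * C)) (ε / (2 * C))), by positivity, fun t ht y hy => ?_⟩
  obtain ⟨z, hzt, hz, hzx, hmono⟩ := hC t ht y (hy.trans (min_le_left _ _))
  have hT : T ∈ Icc t₀ T := ⟨ht₀, le_rfl⟩
  have hy1 : ‖y - x t‖ ≤ δ₁ / (2 * C) := hy.trans ((min_le_right _ _).trans (min_le_left _ _))
  have hy2 : ‖y - x t‖ ≤ ε / (2 * C) := hy.trans ((min_le_right _ _).trans (min_le_right _ _))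
  have h1 := hzx T hT
  have h2 := hmono t ht T hT ht.2
  have h3 := hsup (y := z T) (by
    rw [dist_eq_norm]
    rw [le_div_iff₀ (by positivity)] at hy1
    nlinarith)
  have h4 := h.value_le hφ ht.2 (hz.restrict ht.1 ht.2 le_rfl)
  rw [hzt] at h2 h4
  rw [inner_neg_left] at h3
  have h5 : ε / (2 * C) * ‖z T - x T‖ ≤ ε / 2 * ‖y - x t‖ := by
    calc _ ≤ ε / (2 * C) * (C * ‖y - x t‖) := by gcongr
      _ = _ := by field_simp
  have h6 : C * ‖y - x t‖ ^ 2 ≤ ε / 2 * ‖y - x t‖ := by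
    rw [le_div_iff₀ (by positivity)] at hy2
    nlinarith [norm_nonneg (y - x t)]
  linarith

/-- Forward propagation of the subdifferential. -/
theorem le_value_near (h : StandingHyp F) (hH : HamiltonianHyp F) (hφ : Continuous φ)
    (ht₀ : t₀ ≤ T) (hx : IsOptimal F φ T t₀ x₀ x) (hsys : SolvesHamiltonianSystem F T t₀ x p)
    (hsub : -p t₀ ∈ frechetSub (value F φ T t₀) x₀) {t : ℝ} (ht : t ∈ Icc t₀ T) {ε : ℝ}
    (hε : 0 < ε) :
    ∃ δ : ℝ, 0 < δ ∧ ∀ y : Rn n, ‖y - x t‖ ≤ δ →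
      φ (x T) - inner ℝ (p t) (y - x t) - ε * ‖y - x t‖ ≤ value F φ T t y := by
  obtain ⟨C, hC0, ρ, hρ0, hC⟩ := exists_transport h hH ht₀ hx.1 hsys
  obtain ⟨δ₁, hδ₁, hs⟩ := Metric.eventually_nhds_iff.1
    (eventually_of_mem_frechetSub hsub (show 0 < ε / (2 * C) by positivity))
  have ht₀m : t₀ ∈ Icc t₀ T := ⟨le_rfl, ht₀⟩
  have hV₀ := h.value_eq_of_optimal hφ hx ht₀m
  rw [hx.1.initial] at hV₀
  refine ⟨min ρ (min (δ₁ / (2 * C)) (ε / (2 * C))), by positivity, fun y hy => ?_⟩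
  obtain ⟨z, hzt, hz, hzx, hmono⟩ := hC t ht y (hy.trans (min_le_left _ _))
  have hy1 : ‖y - x t‖ ≤ δ₁ / (2 * C) := hy.trans ((min_le_right _ _).trans (min_le_left _ _))
  have hy2 : ‖y - x t‖ ≤ ε / (2 * C) := hy.trans ((min_le_right _ _).trans (min_le_right _ _))
  have h1 := hzx t₀ ht₀m
  have h2 := hmono t₀ ht₀m t ht ht.1
  rw [hx.1.initial] at h1 h2
  have h3 := hs (y := z t₀) (by
    rw [dist_eq_norm]
    rw [le_div_iff₀ (by positivity)] at hy1
    nlinarith)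
  -- The transported arc joins `(t₀, z t₀)` to `(t, y)`, so the value at the former bounds the value
  -- at the latter from below.
  have h4 := h.value_le_value hφ ht.1 ht.2 (hz.restrict le_rfl ht.1 ht.2)
    ⟨z, hz.restrict ht.1 ht.2 le_rfl⟩
  rw [hzt] at h2 h4
  rw [inner_neg_left, hV₀] at h3
  have h5 : ε / (2 * C) * ‖z t₀ - x₀‖ ≤ ε / 2 * ‖y - x t‖ := by
    calc _ ≤ ε / (2 * C) * (C * ‖y - x t‖) := by gcongr
      _ = _ := by field_simp
  have h6 : C * ‖y - x t‖ ^ 2 ≤ ε / 2 * ‖y - x t‖ := by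
    rw [le_div_iff₀ (by positivity)] at hy2
    nlinarith [norm_nonneg (y - x t)]
  linarith

/-- If the subdifferential of the value function at the initial point is nonempty, then it consists
of the initial value of the adjoint arc (up to the sign). -/
theorem neg_adjoint_mem_frechetSub (h : StandingHyp F) (hH : HamiltonianHyp F) (hφ : Continuous φ)
    (ht₀ : t₀ ≤ T) (hx : IsOptimal F φ T t₀ x₀ x) (hsys : SolvesHamiltonianSystem F T t₀ x p)
    (hpT : -p T ∈ frechetSuper φ (x T)) (hV : (frechetSub (value F φ T t₀) x₀).Nonempty) :
    -p t₀ ∈ frechetSub (value F φ T t₀) x₀ := by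
  obtain ⟨q, hq⟩ := hV
  have ht₀m : t₀ ∈ Icc t₀ T := ⟨le_rfl, ht₀⟩
  have hV₀ := h.value_eq_of_optimal hφ hx ht₀m
  rw [hx.1.initial] at hV₀
  suffices q + p t₀ = 0 by rwa [← eq_neg_of_add_eq_zero_left this]
  refine eq_zero_of_inner_le fun ε hε => ?_
  -- At `t₀` this makes `-p t₀` a supergradient, and a subgradient and a supergradient at one point
  -- coincide.
  obtain ⟨δ, hδ0, hδ⟩ := value_le_near h hH hφ ht₀ hx.1 hsys hpT (half_pos hε)
  have htend : Tendsto (fun y : Rn n => x₀ + y) (𝓝 0) (𝓝 x₀) :=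
    (continuous_const.add continuous_id).tendsto' 0 x₀ (by simp)
  filter_upwards [htend.eventually (eventually_of_mem_frechetSub hq (half_pos hε)),
    Metric.closedBall_mem_nhds (0 : Rn n) hδ0] with y h1 h2
  rw [mem_closedBall_zero_iff] at h2
  have h3 := hδ t₀ ht₀m (x₀ + y) (by rw [hx.1.initial, add_sub_cancel_left]; exact h2)
  rw [hx.1.initial, add_sub_cancel_left] at h3
  rw [add_sub_cancel_left, hV₀] at h1
  rw [inner_add_left]
  linarith

theorem hasGradientAt_value (h : StandingHyp F) (hH : HamiltonianHyp F) (hφ : Continuous φ)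
    (ht₀ : t₀ ≤ T) (hx : IsOptimal F φ T t₀ x₀ x) (hsys : SolvesHamiltonianSystem F T t₀ x p)
    (hpT : -p T ∈ frechetSuper φ (x T)) (hsub : -p t₀ ∈ frechetSub (value F φ T t₀) x₀) {t : ℝ}
    (ht : t ∈ Icc t₀ T) : HasGradientAt (value F φ T t) (-p t) (x t) := by
  rw [hasGradientAt_iff_isLittleO, Asymptotics.isLittleO_iff]
  intro ε hε
  obtain ⟨δ₁, hδ₁0, hδ₁⟩ := value_le_near h hH hφ ht₀ hx.1 hsys hpT hε
  obtain ⟨δ₂, hδ₂0, hδ₂⟩ := le_value_near h hH hφ ht₀ hx hsys hsub ht hε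
  filter_upwards [Metric.closedBall_mem_nhds (x t) hδ₁0, Metric.closedBall_mem_nhds (x t) hδ₂0]
    with y h1 h2
  rw [mem_closedBall_iff_norm] at h1 h2
  have h3 := hδ₁ t ht y h1
  have h4 := hδ₂ y h2
  rw [h.value_eq_of_optimal hφ hx ht, inner_neg_left, Real.norm_eq_abs, abs_le]
  constructor <;> linarith

/-! ### First-order estimates of the value jointly in time and space -/

/-- Upper estimate for the value at later times. -/
theorem value_le_of_le (h : StandingHyp F) (hH : HamiltonianHyp F) (hφ : Continuous φ)
    (ht₀ : t₀ ≤ T) (hx : IsTrajectory F T t₀ x₀ x) (hsys : SolvesHamiltonianSystem F T t₀ x p)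
    (hpT : -p T ∈ frechetSuper φ (x T)) {t : ℝ} (ht : t ∈ Ico t₀ T) {ε : ℝ} (hε : 0 < ε) :
    ∃ δ : ℝ, 0 < δ ∧ ∀ r : ℝ, ∀ y : Rn n, t ≤ r → r - t ≤ δ → ‖y - x t‖ ≤ δ →
      value F φ T r y ≤ φ (x T) + (r - t) * hamiltonian F (x t) (p t) - inner ℝ (p t) (y - x t) +
        ε * (r - t + ‖y - x t‖) := by
  obtain ⟨C, hC0, hC⟩ := h.exists_displacement (x t) (p t)
  set ε₁ := ε / (3 * (1 + C)) with hε₁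
  have hε₁0 : 0 < ε₁ := by positivity
  -- The estimate will be used at the varying time `r`, around `x r`; its uniformity in time is
  -- essential.
  obtain ⟨δ₁, hδ₁0, hδ₁⟩ := value_le_near h hH hφ ht₀ hx hsys hpT hε₁0
  have hpc : ContinuousOn p (Icc t₀ T) := by
    have := hsys.ac_p.continuousOn
    rwa [uIcc_of_le ht₀] at this
  obtain ⟨δ₂, hδ₂0, hδ₂⟩ := Metric.continuousOn_iff.1 hpc t ⟨ht.1, ht.2.le⟩ ε₁ hε₁0
  refine ⟨min (min 1 (T - t)) (min (δ₁ / (2 + C)) (min (δ₂ / 2) ε₁)),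
    lt_min (lt_min one_pos (sub_pos.2 ht.2)) (by positivity), fun r y htr hr hy => ?_⟩
  have hr1 : r - t ≤ 1 := hr.trans ((min_le_left _ _).trans (min_le_left _ _))
  have hrT : r ≤ T := by
    linarith [hr.trans ((min_le_left _ _).trans (min_le_right _ _))]
  have hm1 := (min_le_right (min 1 (T - t)) (min (δ₁ / (2 + C)) (min (δ₂ / 2) ε₁)))
  have hrδ : r - t ≤ δ₁ / (2 + C) := hr.trans (hm1.trans (min_le_left _ _))
  have hyδ : ‖y - x t‖ ≤ δ₁ / (2 + C) := hy.trans (hm1.trans (min_le_left _ _))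
  have hrδ₂ : r - t ≤ δ₂ / 2 :=
    hr.trans (hm1.trans ((min_le_right _ _).trans (min_le_left _ _)))
  have hrε : r - t ≤ ε₁ := hr.trans (hm1.trans ((min_le_right _ _).trans (min_le_right _ _)))
  have hrm : r ∈ Icc t₀ T := ⟨ht.1.trans htr, hrT⟩
  obtain ⟨h1, h2⟩ := hC t r htr hr1 (x t) (by simp) x (hx.restrict ht.1 htr hrT)
  rw [sub_self, norm_zero, add_zero] at h2
  set τ := r - t with hτ
  have hτ0 : 0 ≤ τ := sub_nonneg.2 htr
  have hN : ‖y - x r‖ ≤ (1 + C) * (τ + ‖y - x t‖) := by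
    have h3 := norm_sub_le_norm_sub_add_norm_sub y (x t) (x r)
    rw [norm_sub_rev (x t)] at h3
    nlinarith [norm_nonneg (y - x t)]
  have h4 := hδ₁ r hrm y (by
    rw [le_div_iff₀ (by positivity)] at hrδ hyδ
    have h3 := norm_sub_le_norm_sub_add_norm_sub y (x t) (x r)
    rw [norm_sub_rev (x t)] at h3
    nlinarith [norm_nonneg (y - x t)])
  have h5 : ‖p r - p t‖ ≤ ε₁ := by
    rw [← dist_eq_norm]
    refine (hδ₂ r hrm ?_).le
    rw [Real.dist_eq, abs_of_nonneg hτ0]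
    linarith
  have h6 : -inner ℝ (p r) (y - x r) ≤ -inner ℝ (p t) (y - x r) + ε₁ * ‖y - x r‖ := by
    have e1 := neg_le_abs (inner ℝ (p r - p t) (y - x r))
    have e2 := abs_real_inner_le_norm (p r - p t) (y - x r)
    have e3 : ‖p r - p t‖ * ‖y - x r‖ ≤ ε₁ * ‖y - x r‖ := by gcongr
    rw [inner_sub_left] at e1 e2
    linarith
  have h7 : inner ℝ (p t) (y - x r) = inner ℝ (p t) (y - x t) - inner ℝ (p t) (x r - x t) := by
    rw [← inner_sub_right, sub_sub_sub_cancel_right]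
  have h8 : ε₁ * ‖y - x r‖ ≤ ε / 3 * (τ + ‖y - x t‖) := by
    calc _ ≤ ε₁ * ((1 + C) * (τ + ‖y - x t‖)) := by gcongr
      _ = _ := by rw [hε₁]; field_simp
  have h9 : τ * (C * τ) ≤ ε / 3 * (τ + ‖y - x t‖) := by
    have e1 : C * τ ≤ ε / 3 := by
      calc C * τ ≤ (1 + C) * ε₁ := by gcongr; linarith
        _ = ε / 3 := by rw [hε₁]; field_simp
    calc _ ≤ τ * (ε / 3) := by gcongr
      _ ≤ _ := by nlinarith [norm_nonneg (y - x t)]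
  linarith

/-- Lower estimate for the value at earlier times. -/
theorem le_value_of_le (h : StandingHyp F) (hH : HamiltonianHyp F) (hφ : Continuous φ)
    (ht₀ : t₀ ≤ T) (hx : IsOptimal F φ T t₀ x₀ x) (hsys : SolvesHamiltonianSystem F T t₀ x p)
    (hsub : -p t₀ ∈ frechetSub (value F φ T t₀) x₀) {t : ℝ} (ht : t ∈ Icc t₀ T) {ε : ℝ}
    (hε : 0 < ε) :
    ∃ δ : ℝ, 0 < δ ∧ ∀ r : ℝ, ∀ y : Rn n, r ≤ t → t - r ≤ δ → ‖y - x t‖ ≤ δ →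
      (∃ z, IsTrajectory F T r y z) →
      φ (x T) + (r - t) * hamiltonian F (x t) (p t) - inner ℝ (p t) (y - x t) -
        ε * (t - r + ‖y - x t‖) ≤ value F φ T r y := by
  obtain ⟨C, hC0, hC⟩ := h.exists_displacement (x t) (p t)
  obtain ⟨δ₁, hδ₁0, hδ₁⟩ := le_value_near h hH hφ ht₀ hx hsys hsub ht
    (show 0 < ε / (2 * (1 + C)) by positivity)
  refine ⟨min 1 (min (δ₁ / (2 + C)) (ε / (4 * C))), by positivity,
    fun r y hrt hr hy hne => le_value hne fun z hz => ?_⟩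
  have hr1 : t - r ≤ 1 := hr.trans (min_le_left _ _)
  have hy1 : ‖y - x t‖ ≤ 1 := hy.trans (min_le_left _ _)
  have hrδ : t - r ≤ δ₁ / (2 + C) := hr.trans ((min_le_right _ _).trans (min_le_left _ _))
  have hyδ : ‖y - x t‖ ≤ δ₁ / (2 + C) := hy.trans ((min_le_right _ _).trans (min_le_left _ _))
  have hrε : t - r ≤ ε / (4 * C) := hr.trans ((min_le_right _ _).trans (min_le_right _ _))
  have hyε : ‖y - x t‖ ≤ ε / (4 * C) := hy.trans ((min_le_right _ _).trans (min_le_right _ _))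
  have hz1 := hz.restrict le_rfl hrt ht.2
  rw [hz.initial] at hz1
  -- The displacement bound is uniform over all competitors `z`, so it survives the infimum.
  obtain ⟨h1, h2⟩ := hC r t hrt hr1 y hy1 z hz1
  have h3 := norm_sub_le_norm_sub_add_norm_sub (z t) y (x t)
  set τ := t - r with hτ
  have hτ0 : 0 ≤ τ := sub_nonneg.2 hrt
  have h4 := hδ₁ (z t) (by
    rw [le_div_iff₀ (by positivity)] at hrδ hyδ
    nlinarith [norm_nonneg (y - x t)])
  have h5 := h.value_le hφ ht.2 (hz.restrict hrt ht.2 le_rfl)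
  have h6 : inner ℝ (p t) (z t - x t) = inner ℝ (p t) (y - x t) + inner ℝ (p t) (z t - y) := by
    rw [← inner_add_right, sub_add_sub_cancel']
  have h7 : ε / (2 * (1 + C)) * ‖z t - x t‖ ≤ ε / 2 * (τ + ‖y - x t‖) := by
    calc _ ≤ ε / (2 * (1 + C)) * ((1 + C) * (τ + ‖y - x t‖)) := by
          gcongr
          nlinarith [norm_nonneg (y - x t)]
      _ = _ := by field_simp
  have h8 : τ * (C * (τ + ‖y - x t‖)) ≤ ε / 2 * (τ + ‖y - x t‖) := by
    have e1 : C * (τ + ‖y - x t‖) ≤ ε / 2 := by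
      rw [le_div_iff₀ (by positivity)] at hrε hyε
      nlinarith
    have : τ * (C * (τ + ‖y - x t‖)) ≤ τ * (ε / 2) := by gcongr
    nlinarith [norm_nonneg (y - x t)]
  have h9 : r - t = -τ := by rw [hτ]; ring
  rw [h9]
  linarith

/-- A short trajectory from `y` at time `r` reaching the vicinity of `x₁` at time `t`, with the
first-order effect on the pairing with `q`. -/
theorem exists_short_estimate (h : StandingHyp F) (x₁ q : Rn n) :
    ∃ C : ℝ, 0 < C ∧ ∃ ρ : ℝ, 0 < ρ ∧ ∀ r t : ℝ, ∀ y : Rn n, |t - r| ≤ ρ → ‖y - x₁‖ ≤ ρ →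
      ∃ z : ℝ → Rn n, ∃ K : NNReal, z r = y ∧ LipschitzWith K z ∧
        (∀ᵐ s ∂(volume.restrict (uIcc r t)), ∃ v ∈ F (z s), HasDerivAt z v s) ∧
        ‖z t - x₁‖ ≤ C * (|t - r| + ‖y - x₁‖) ∧
        |inner ℝ q (z t - x₁) - (inner ℝ q (y - x₁) + (t - r) * hamiltonian F x₁ q)| ≤
          C * |t - r| * (|t - r| + ‖y - x₁‖) := by
  -- Taking a maximising velocity makes the first-order term exactly `(t - r) * H(x₁,q)`, for either
  -- sign of `t - r`.
  obtain ⟨v₀, hv₀, hv₀q⟩ := h.exists_eq_hamiltonian x₁ q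
  obtain ⟨C, hC0, ρ, hρ0, hC⟩ := h.exists_short_trajectory hv₀
  refine ⟨1 + ‖v₀‖ + C * (1 + ‖q‖), by positivity, min ρ 1, by positivity,
    fun r t y hr hy => ?_⟩
  obtain ⟨z, K, hzr, hzK, hzt, hzd⟩ := hC r t y (hr.trans (min_le_left _ _))
    (hy.trans (min_le_left _ _))
  refine ⟨z, K, hzr, hzK, hzd, ?_, ?_⟩
  · have e : z t - x₁ = (y - x₁) + (t - r) • v₀ + (z t - (y + (t - r) • v₀)) := by abel
    rw [e]
    refine (norm_add₃_le ..).trans ?_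
    rw [norm_smul, Real.norm_eq_abs]
    have h1 : C * |t - r| * (|t - r| + ‖y - x₁‖) ≤ C * 1 * (|t - r| + ‖y - x₁‖) := by
      gcongr
      exact hr.trans (min_le_right _ _)
    have h2 : 0 ≤ C * ‖q‖ * (|t - r| + ‖y - x₁‖) := by positivity
    have h3 : 0 ≤ ‖v₀‖ * ‖y - x₁‖ := by positivity
    linarith [abs_nonneg (t - r)]
  · have e : inner ℝ q (z t - x₁) - (inner ℝ q (y - x₁) + (t - r) * hamiltonian F x₁ q) =
        inner ℝ q (z t - (y + (t - r) • v₀)) := by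
      rw [← hv₀q, real_inner_comm q v₀, ← inner_smul_right, ← inner_add_right, ← inner_sub_right]
      congr 1
      abel
    rw [e]
    refine (abs_real_inner_le_norm _ _).trans ?_
    calc _ ≤ ‖q‖ * (C * |t - r| * (|t - r| + ‖y - x₁‖)) := by gcongr
      _ = C * ‖q‖ * (|t - r| * (|t - r| + ‖y - x₁‖)) := by ring
      _ ≤ (1 + ‖v₀‖ + C * (1 + ‖q‖)) * (|t - r| * (|t - r| + ‖y - x₁‖)) := by
        gcongr
        linarith [norm_nonneg v₀]
      _ = _ := by ring

/-- Upper estimate for the value at earlier times. -/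
theorem value_le_of_ge (h : StandingHyp F) (hH : HamiltonianHyp F) (hφ : Continuous φ)
    (ht₀ : t₀ ≤ T) (hx : IsTrajectory F T t₀ x₀ x) (hsys : SolvesHamiltonianSystem F T t₀ x p)
    (hpT : -p T ∈ frechetSuper φ (x T)) {t : ℝ} (ht : t ∈ Icc t₀ T) {ε : ℝ} (hε : 0 < ε) :
    ∃ δ : ℝ, 0 < δ ∧ ∀ r : ℝ, ∀ y : Rn n, r ≤ t → t - r ≤ δ → ‖y - x t‖ ≤ δ →
      (∃ z, IsTrajectory F T r y z) ∧
      value F φ T r y ≤ φ (x T) + (r - t) * hamiltonian F (x t) (p t) - inner ℝ (p t) (y - x t) +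
        ε * (t - r + ‖y - x t‖) := by
  obtain ⟨C, hC0, ρ, hρ0, hC⟩ := exists_short_estimate h (x t) (p t)
  obtain ⟨ρ₁, hρ₁0, hρ₁⟩ := exists_trajectory_near h hH ht₀ hx hsys
  obtain ⟨δ₁, hδ₁0, hδ₁⟩ := value_le_near h hH hφ ht₀ hx hsys hpT
    (show 0 < ε / (2 * C) by positivity)
  refine ⟨min ρ (min (min ρ₁ δ₁ / (2 * C)) (ε / (2 * C))), by positivity,
    fun r y hrt hr hy => ?_⟩
  have habs : |t - r| = t - r := abs_of_nonneg (sub_nonneg.2 hrt)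
  obtain ⟨z, K, hzr, hzK, hzd, hzt, hzq⟩ := hC r t y
    (by rw [habs]; exact hr.trans (min_le_left _ _)) (hy.trans (min_le_left _ _))
  rw [habs] at hzt hzq
  rw [uIcc_of_le hrt] at hzd
  have hrδ : t - r ≤ min ρ₁ δ₁ / (2 * C) := hr.trans ((min_le_right _ _).trans (min_le_left _ _))
  have hyδ : ‖y - x t‖ ≤ min ρ₁ δ₁ / (2 * C) :=
    hy.trans ((min_le_right _ _).trans (min_le_left _ _))
  have hrε : t - r ≤ ε / (2 * C) := hr.trans ((min_le_right _ _).trans (min_le_right _ _))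
  have hnear : ‖z t - x t‖ ≤ min ρ₁ δ₁ := by
    rw [le_div_iff₀ (by positivity)] at hrδ hyδ
    linarith
  have hztraj : IsTrajectory F t r y z := by
    rw [← hzr]
    exact IsTrajectory.of_lipschitz hzK.lipschitzOnWith hzd
  -- Prolonging the short arc to `T` also supplies the nonemptiness that `le_value_of_le` asks for.
  obtain ⟨q, hq⟩ := hρ₁ t ht (z t) (hnear.trans (min_le_left _ _))
  obtain ⟨w, hw, -⟩ := h.exists_concat hrt ht.2 hztraj hq
  refine ⟨⟨w, hw⟩, ?_⟩
  have h1 := h.value_le_value hφ hrt ht.2 hztraj ⟨q, hq⟩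
  have h2 := hδ₁ t ht (z t) (hnear.trans (min_le_right _ _))
  have h3 : ε / (2 * C) * ‖z t - x t‖ ≤ ε / 2 * (t - r + ‖y - x t‖) := by
    calc _ ≤ ε / (2 * C) * (C * (t - r + ‖y - x t‖)) := by gcongr
      _ = _ := by field_simp
  have h4 : C * (t - r) * (t - r + ‖y - x t‖) ≤ ε / 2 * (t - r + ‖y - x t‖) := by
    have : 0 ≤ t - r + ‖y - x t‖ := add_nonneg (sub_nonneg.2 hrt) (norm_nonneg _)
    refine mul_le_mul_of_nonneg_right ?_ this
    rw [le_div_iff₀ (by positivity)] at hrε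
    linarith
  have h5 := (abs_le.1 hzq).1
  linarith

/-- Lower estimate for the value at later times. -/
theorem le_value_of_ge (h : StandingHyp F) (hH : HamiltonianHyp F) (hφ : Continuous φ)
    (ht₀ : t₀ ≤ T) (hx : IsOptimal F φ T t₀ x₀ x) (hsys : SolvesHamiltonianSystem F T t₀ x p)
    (hsub : -p t₀ ∈ frechetSub (value F φ T t₀) x₀) {t : ℝ} (ht : t ∈ Ico t₀ T) {ε : ℝ}
    (hε : 0 < ε) :
    ∃ δ : ℝ, 0 < δ ∧ ∀ r : ℝ, ∀ y : Rn n, t ≤ r → r - t ≤ δ → ‖y - x t‖ ≤ δ →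
      φ (x T) + (r - t) * hamiltonian F (x t) (p t) - inner ℝ (p t) (y - x t) -
        ε * (r - t + ‖y - x t‖) ≤ value F φ T r y := by
  have ht' : t ∈ Icc t₀ T := ⟨ht.1, ht.2.le⟩
  obtain ⟨C, hC0, ρ, hρ0, hC⟩ := exists_short_estimate h (x t) (p t)
  obtain ⟨ρ₁, hρ₁0, hρ₁⟩ := exists_trajectory_near h hH ht₀ hx.1 hsys
  obtain ⟨δ₁, hδ₁0, hδ₁⟩ := le_value_near h hH hφ ht₀ hx hsys hsub ht'
    (show 0 < ε / (2 * C) by positivity)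
  have hxc : ContinuousOn x (Icc t₀ T) := by
    have := hx.1.ac.continuousOn
    rwa [uIcc_of_le ht₀] at this
  obtain ⟨δ₂, hδ₂0, hδ₂⟩ := Metric.continuousOn_iff.1 hxc t ht' (ρ₁ / 2) (by positivity)
  refine ⟨min (min ρ (min (T - t) (min (ρ₁ / 2) (δ₂ / 2)))) (min (δ₁ / (2 * C)) (ε / (2 * C))),
    lt_min (lt_min hρ0 (lt_min (sub_pos.2 ht.2) (by positivity))) (by positivity),
    fun r y htr hr hy => ?_⟩
  have habs : |t - r| = r - t := by rw [abs_sub_comm]; exact abs_of_nonneg (sub_nonneg.2 htr)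
  simp only [le_min_iff] at hr hy
  obtain ⟨⟨hrρ, hrT, -, hrδ₂⟩, hrδ, hrε⟩ := hr
  obtain ⟨⟨hyρ, -, hyρ₁, -⟩, hyδ, -⟩ := hy
  have hrm : r ∈ Icc t₀ T := ⟨ht.1.trans htr, by linarith⟩
  -- Here `t ≤ r`: the arc is built backward from `(r, y)`, so that dynamic programming gives `V(t,
  -- z t) ≤ V(r, y)`.
  obtain ⟨z, K, hzr, hzK, hzd, hzt, hzq⟩ := hC r t y (by rwa [habs]) hyρ
  rw [habs] at hzt hzq
  rw [uIcc_of_ge htr] at hzd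
  have hnear : ‖z t - x t‖ ≤ δ₁ := by
    rw [le_div_iff₀ (by positivity)] at hrδ hyδ
    linarith
  have hztraj : IsTrajectory F r t (z t) z :=
    IsTrajectory.of_lipschitz hzK.lipschitzOnWith hzd
  have hyr : ‖y - x r‖ ≤ ρ₁ := by
    have h1 := norm_sub_le_norm_sub_add_norm_sub y (x t) (x r)
    have h2 := hδ₂ r hrm (by rw [Real.dist_eq, abs_of_nonneg (sub_nonneg.2 htr)]; linarith)
    rw [dist_eq_norm, norm_sub_rev] at h2
    linarith
  have h1 := h.value_le_value hφ htr hrm.2 hztraj (by rw [hzr]; exact hρ₁ r hrm y hyr)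
  have h2 := hδ₁ (z t) hnear
  have h3 : ε / (2 * C) * ‖z t - x t‖ ≤ ε / 2 * (r - t + ‖y - x t‖) := by
    calc _ ≤ ε / (2 * C) * (C * (r - t + ‖y - x t‖)) := by gcongr
      _ = _ := by field_simp
  have h4 : C * (r - t) * (r - t + ‖y - x t‖) ≤ ε / 2 * (r - t + ‖y - x t‖) := by
    have : 0 ≤ r - t + ‖y - x t‖ := add_nonneg (sub_nonneg.2 htr) (norm_nonneg _)
    refine mul_le_mul_of_nonneg_right ?_ this
    rw [le_div_iff₀ (by positivity)] at hrε
    linarith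
  have h5 := (abs_le.1 hzq).2
  rw [hzr] at h1
  linarith

theorem hasGradientAt_value_prod (h : StandingHyp F) (hH : HamiltonianHyp F) (hφ : Continuous φ)
    (ht₀ : t₀ ≤ T) (hx : IsOptimal F φ T t₀ x₀ x) (hsys : SolvesHamiltonianSystem F T t₀ x p)
    (hpT : -p T ∈ frechetSuper φ (x T)) (hsub : -p t₀ ∈ frechetSub (value F φ T t₀) x₀) {t : ℝ}
    (ht : t ∈ Ico t₀ T) :
    HasGradientAt (fun z : WithLp 2 (ℝ × Rn n) => value F φ T z.fst z.snd)
      (WithLp.toLp 2 (hamiltonian F (x t) (p t), -p t)) (WithLp.toLp 2 (t, x t)) := by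
  have ht' : t ∈ Icc t₀ T := ⟨ht.1, ht.2.le⟩
  rw [hasGradientAt_iff_isLittleO, Asymptotics.isLittleO_iff]
  intro ε hε
  -- `|z.fst - t|` and `‖z.snd - x t‖` are each at most the product norm, so their sum costs a
  -- factor `2`.
  have hε2 := half_pos hε
  obtain ⟨δ₁, hδ₁0, hδ₁⟩ := value_le_of_le h hH hφ ht₀ hx.1 hsys hpT ht hε2
  obtain ⟨δ₂, hδ₂0, hδ₂⟩ := le_value_of_ge h hH hφ ht₀ hx hsys hsub ht hε2
  obtain ⟨δ₃, hδ₃0, hδ₃⟩ := value_le_of_ge h hH hφ ht₀ hx.1 hsys hpT ht' hε2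
  obtain ⟨δ₄, hδ₄0, hδ₄⟩ := le_value_of_le h hH hφ ht₀ hx hsys hsub ht' hε2
  filter_upwards [Metric.closedBall_mem_nhds (WithLp.toLp 2 (t, x t))
    (show 0 < min (min δ₁ δ₂) (min δ₃ δ₄) by positivity)] with z hz
  rw [mem_closedBall_iff_norm] at hz
  have hfst : |z.fst - t| ≤ ‖z - WithLp.toLp 2 (t, x t)‖ := by
    have := WithLp.norm_fst_le ℝ (z - WithLp.toLp 2 (t, x t))
    simpa using this
  have hsnd : ‖z.snd - x t‖ ≤ ‖z - WithLp.toLp 2 (t, x t)‖ := by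
    have := WithLp.norm_snd_le ℝ (z - WithLp.toLp 2 (t, x t))
    simpa using this
  have e : inner ℝ (WithLp.toLp 2 (hamiltonian F (x t) (p t), -p t))
      (z - WithLp.toLp 2 (t, x t)) =
      (z.fst - t) * hamiltonian F (x t) (p t) - inner ℝ (p t) (z.snd - x t) := by
    rw [WithLp.prod_inner_apply]
    simp [sub_eq_add_neg]
  rw [e]
  change ‖value F φ T z.fst z.snd - value F φ T t (x t) - _‖ ≤ _
  rw [h.value_eq_of_optimal hφ hx ht', Real.norm_eq_abs]
  set N := ‖z - WithLp.toLp 2 (t, x t)‖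
  simp only [le_min_iff] at hz
  obtain ⟨⟨hz1, hz2⟩, hz3, hz4⟩ := hz
  have hsum : ε / 2 * (|z.fst - t| + ‖z.snd - x t‖) ≤ ε * N := by
    calc _ ≤ ε / 2 * (N + N) := by gcongr
      _ = _ := by ring
  rcases le_total t z.fst with hle | hle
  · have ha : |z.fst - t| = z.fst - t := abs_of_nonneg (sub_nonneg.2 hle)
    rw [ha] at hfst hsum
    have h1 := hδ₁ _ z.snd hle (hfst.trans hz1) (hsnd.trans hz1)
    have h2 := hδ₂ _ z.snd hle (hfst.trans hz2) (hsnd.trans hz2)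
    rw [abs_le]
    constructor <;> linarith
  · have ha : |z.fst - t| = t - z.fst := by
      rw [abs_sub_comm]; exact abs_of_nonneg (sub_nonneg.2 hle)
    rw [ha] at hfst hsum
    obtain ⟨hne, h1⟩ := hδ₃ _ z.snd hle (hfst.trans hz3) (hsnd.trans hz3)
    have h2 := hδ₄ _ z.snd hle (hfst.trans hz4) (hsnd.trans hz4) hne
    rw [abs_le]
    constructor <;> linarith

end Sensitivity

end Mayer

theorem mainTheorem8 (n : ℕ) (F : Mayer.Rn n → Set (Mayer.Rn n))
    (hSH : Mayer.StandingHyp F) (hH : Mayer.HamiltonianHyp F)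
    (φ : Mayer.Rn n → ℝ) (hφ : LocallyLipschitz φ)
    (T t₀ : ℝ) (ht₀ : t₀ ≤ T) (x₀ : Mayer.Rn n)
    (x p : ℝ → Mayer.Rn n)
    (hx : Mayer.IsOptimal F φ T t₀ x₀ x)
    (hsys : Mayer.SolvesHamiltonianSystem F T t₀ x p)
    (hpT : -p T ∈ Mayer.frechetSuper φ (x T))
    (hV : (Mayer.frechetSub (Mayer.value F φ T t₀) x₀).Nonempty) :
    (∀ t ∈ Set.Icc t₀ T, HasGradientAt (Mayer.value F φ T t) (-p t) (x t)) ∧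
    (Mayer.LocallySemiconcave φ → ∀ t ∈ Set.Ico t₀ T,
      HasGradientAt (fun z : WithLp 2 (ℝ × Mayer.Rn n) => Mayer.value F φ T z.fst z.snd)
        (WithLp.toLp 2 (Mayer.hamiltonian F (x t) (p t), -p t))
        (WithLp.toLp 2 (t, x t))) := by
  have hsub := Mayer.neg_adjoint_mem_frechetSub hSH hH hφ.continuous ht₀ hx hsys hpT hV
  exact ⟨fun t ht => Mayer.hasGradientAt_value hSH hH hφ.continuous ht₀ hx hsys hpT hsub ht,
    fun _ t ht => Mayer.hasGradientAt_value_prod hSH hH hφ.continuous ht₀ hx hsys hpT hsub ht⟩
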